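/- Let $s$ be a fixed positive integer. An input of the decision problem Monotone $\forall\exists$ NAE-3-SAT-$(s,2)$ is a quantified Boolean formula $$\forall x_1 \cdots \forall x_p\, \exists x_{p+1} \cdots \exists x_n \bigwedge_{j=1}^m C_j$$ such that each clause $C_j$ is a disjunction of exactly three distinct unnegated variables from $\{x_1,\dots,x_n\}$ and, amongst the clauses, each universal variable $x_1,\dots,x_p$ appears exactly $s$ times and each existential variable $x_{p+1},\dots,x_n$ appears exactly twice. The question is whether, for every truth assignment for $\{x_1,\dots,x_p\}$, there exists a truth assignment for $\{x_{p+1},\dots,x_n\}$ such that in each clause at least one, but not all three, of the variables are true. Then, for every fixed positive integer $s$, Monotone $\forall\exists$ NAE-3-SAT-$(s,2)$ is in co-NP; that is, the complement of the language of (encodings of) its yes-instances is in NP. -/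

import Mathlib

open Computability Turing

namespace ForallExistsNAE

/-! ### The complexity classes NP and co-NP

Problems are languages of bit strings.  The machine model is Mathlib's multi-stack Turing machine
`Turing.FinTM2`, and polynomial time is Mathlib's `Turing.TM2ComputableInPolyTime`. -/

/-- The pair `(x, c)` of bit strings is written on the input tape as `x # c`, with the separator
`# = none`. -/
def encodePair (xc : List Bool × List Bool) : List (Option Bool) :=
  xc.1.map some ++ none :: xc.2.map some

/-- `L` is in NP: there are a polynomial-time decidable relation `V` and a polynomial `p` such that
`x ∈ L` iff some certificate `c` of length at most `p(|x|)` satisfies `V (x, c)`. -/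
def InNP (L : Set (List Bool)) : Prop :=
  ∃ (V : List Bool × List Bool → Bool) (p : Polynomial ℕ),
    Nonempty (TM2ComputableInPolyTime encodePair encodeBool V) ∧
      ∀ x : List Bool, x ∈ L ↔ ∃ c : List Bool, c.length ≤ p.eval x.length ∧ V (x, c) = true

/-- `L` is in co-NP: its complement is in NP. -/
def InCoNP (L : Set (List Bool)) : Prop := InNP Lᶜ

/-! ### Monotone quantified Boolean formulas -/

/-- A monotone quantified Boolean formula `∀ x₁ ⋯ ∀ xₚ ∃ xₚ₊₁ ⋯ ∃ xₙ ⋀ⱼ Cⱼ` in which each `Cⱼ` is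
a disjunction of three unnegated variables.  Here `p = numUniv`, `n = numUniv + numExist`, and the
variable `xᵢ₊₁` is represented by `i : Fin n`.  Clauses form a list, so that a clause may be
repeated, and repetitions count as further appearances of its variables. -/
structure MonotoneQBF where
  numUniv : ℕ
  numExist : ℕ
  clauses : List (Fin 3 → Fin (numUniv + numExist))

/-- A clause is nae-satisfied by `β` if at least one of its literals, but not all of them, is
true. -/
def NAESatisfied {n : ℕ} (β : Fin n → Bool) (C : Fin 3 → Fin n) : Prop :=
  (∃ k, β (C k) = true) ∧ (∃ k, β (C k) = false)

namespace MonotoneQBF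

variable (Φ : MonotoneQBF)

/-- All appearances of variables in the formula, clause by clause. -/
def appearances : List (Fin (Φ.numUniv + Φ.numExist)) :=
  Φ.clauses.flatMap List.ofFn

/-- `Φ` is an input of Monotone ∀∃ NAE-3-SAT-`(s, t)`: each clause contains three distinct
variables, each universal variable appears exactly `s` times and each existential variable appears
exactly `t` times. -/
def IsInput (s t : ℕ) : Prop :=
  (∀ C ∈ Φ.clauses, Function.Injective C) ∧
  (∀ i : Fin Φ.numUniv, Φ.appearances.count (Fin.castAdd Φ.numExist i) = s) ∧
  (∀ i : Fin Φ.numExist, Φ.appearances.count (Fin.natAdd Φ.numUniv i) = t)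

/-- For every truth assignment `β` of the universal variables there is a truth assignment `γ` of
the existential variables such that `β` and `γ` together nae-satisfy every clause. -/
def IsYes : Prop :=
  ∀ β : Fin Φ.numUniv → Bool, ∃ γ : Fin Φ.numExist → Bool,
    ∀ C ∈ Φ.clauses, NAESatisfied (Fin.append β γ) C

/-- The numeral `1ᵏ0`. -/
def encodeNumeral (k : ℕ) : List Bool := List.replicate k true ++ [false]

/-- `Φ` as a bit string: the number of universal variables, the number of existential variables,
and then the indices of the variables, clause by clause.  Unary numerals are a reasonable encoding:
in an input every variable appears (for `s, t ≥ 1`), so that `n ≤ 3m` for `n` variables and `m`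
clauses, and the length of the code is at most quadratic in `m`. -/
def encode : List Bool :=
  encodeNumeral Φ.numUniv ++ encodeNumeral Φ.numExist ++
    Φ.appearances.flatMap (fun i : Fin _ => encodeNumeral i.val)

end MonotoneQBF

/-- The decision problem Monotone ∀∃ NAE-3-SAT-`(s, t)`, for fixed `s` and `t`: the set of all codes
of yes-instances.  (Strings that encode no input are not in the language.) -/
def MonotoneForallExistsNAE3SAT (s t : ℕ) : Set (List Bool) :=
  {w | ∃ Φ : MonotoneQBF, Φ.IsInput s t ∧ Φ.IsYes ∧ w = Φ.encode}

end ForallExistsNAE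

namespace ForallExistsNAE

/-! ### Obstructions to nae-satisfiability -/

section Obstruction

set_option linter.unusedSectionVars false

variable {ι V : Type*} [Fintype ι] [DecidableEq ι] [DecidableEq V]

/-! Fix an assignment of the universal variables. Each existential variable lies in exactly two
clauses, so clauses and existential variables form the vertices and edges of a multigraph. An
`Obstruction` is a union `T` of components of this graph, properly 2-coloured by `d`, such that
every fixed variable in a clause `D` of `T` has the value `d D`, and with fewer edges than vertices
(the field `count` is this inequality doubled). It rules out an extension: each `D` in `T` needs an
edge with value different from `d D`, while each edge serves exactly one of its two ends because `d`
alternates (`Obstruction.not_naeFamily`).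

Conversely, obstructions are the only reason for failure (`exists_naeFamily_or_obstruction`), by
induction on the set `U` of free variables. If both values of a new variable `x` are obstructed, the
two obstructions are merged: the clauses coloured differently are discarded
(`exists_obstruction_of_update`), then either the common part is itself an obstruction or the union
is one, `x` being a new edge that joins two pieces (`Obstruction.union`).

Hence a no-instance has a short certificate, namely a partial 2-colouring of the clauses. The
universal assignment need not be supplied, since it can be read off the colours
(`ValidInput.obstruction`), and all conditions become local: no universal variable sees both
colours, each existential variable sees no colour or both, and, every clause having three variables,
the inequality says that coloured clauses contain more universal appearances than there are coloured
clauses (`ValidInput.count_iff`).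

The rest is a machine that checks this. It makes one pass over the formula per variable, shortening
the unary numerals by one each time, so that the numerals ending in pass `i` are the appearances of
variable `i`. A stack with one mark per coloured clause loses a mark at each universal appearance in
a coloured clause; the inequality holds iff it underflows. Malformed inputs are accepted, as they
belong to the complement. -/

/-- A counting obstruction to extending the assignment `α`, from outside `U` to all variables, so
that every clause `S D` is nae-satisfied. -/
structure Obstruction (S : ι → Finset V) (U : Finset V) (α : V → Bool) (T : Finset ι)
    (d : ι → Bool) : Prop where
  fixed : ∀ D ∈ T, ∀ y ∈ S D, y ∉ U → α y = d D
  closed : ∀ D ∈ T, ∀ y ∈ S D, y ∈ U → ∀ D', y ∈ S D' → D' ∈ T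
  alternating : ∀ D ∈ T, ∀ D' ∈ T, D ≠ D' → ∀ y ∈ S D, y ∈ S D' → y ∈ U → d D ≠ d D'
  count : ∑ D ∈ T, (U ∩ S D).card < 2 * T.card

/-- Every set of the family `S` is nae-satisfied by `γ`. -/
def NAEFamily (S : ι → Finset V) (γ : V → Bool) : Prop :=
  ∀ D, (∃ y ∈ S D, γ y = true) ∧ ∃ y ∈ S D, γ y = false

theorem sum_card_inter_eq (S : ι → Finset V) (U : Finset V) (T : Finset ι) :
    ∑ D ∈ T, (U ∩ S D).card = ∑ y ∈ U, (T.filter (fun D => y ∈ S D)).card := by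
  have h := Finset.sum_card_bipartiteAbove_eq_sum_card_bipartiteBelow
    (s := T) (t := U) (fun D y => y ∈ S D)
  simp only [Finset.bipartiteAbove, Finset.bipartiteBelow] at h
  rw [← h]
  refine Finset.sum_congr rfl fun D _ => ?_
  congr 1

/-- Count by variables: closedness makes a free variable met by `T` contribute both of its clauses,
any other contributes none. -/
theorem even_sum_card_inter {S : ι → Finset V} {U : Finset V} {T : Finset ι}
    (hU : ∀ y ∈ U, (Finset.univ.filter (fun D => y ∈ S D)).card = 2)
    (hT : ∀ D ∈ T, ∀ y ∈ S D, y ∈ U → ∀ D', y ∈ S D' → D' ∈ T) :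
    Even (∑ D ∈ T, (U ∩ S D).card) := by
  rw [sum_card_inter_eq]
  refine Finset.even_sum _ fun y hy => ?_
  by_cases h : ∃ D ∈ T, y ∈ S D
  · obtain ⟨D, hD, hyD⟩ := h
    have : T.filter (fun D => y ∈ S D) = Finset.univ.filter (fun D => y ∈ S D) := by
      ext D'
      simp only [Finset.mem_filter, Finset.mem_univ, true_and, and_iff_right_iff_imp]
      exact hT D hD y hyD hy D'
    rw [this, hU y hy]
    exact even_two
  · push Not at h
    rw [Finset.filter_eq_empty_iff.2 fun {D} hD => h D hD]
    simp

/-- Call `y` useful for `D` if `γ y ≠ d D`. Every clause of `T` needs a useful free variable, but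
each free variable meeting `T` is useful for just one clause, so there would be at least as many
edges as clauses. -/
theorem Obstruction.not_naeFamily {S : ι → Finset V} {U : Finset V} {α : V → Bool} {T : Finset ι}
    {d : ι → Bool} (h : Obstruction S U α T d)
    (hU : ∀ y ∈ U, (Finset.univ.filter (fun D => y ∈ S D)).card = 2)
    {γ : V → Bool} (hγ : ∀ y ∉ U, γ y = α y) : ¬ NAEFamily S γ := by
  intro hS
  -- The two clauses through `y` have opposite colours, so `γ y` differs from exactly one of them.
  have hsplit : ∀ y ∈ U, (T.filter (fun D => y ∈ S D)).card
      = 2 * (T.filter (fun D => y ∈ S D ∧ γ y ≠ d D)).card := by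
    intro y hy
    by_cases hex : ∃ D ∈ T, y ∈ S D
    · obtain ⟨D, hD, hyD⟩ := hex
      obtain ⟨A, B, hAB, hE⟩ := Finset.card_eq_two.1 (hU y hy)
      have hmem : ∀ D', y ∈ S D' ↔ D' = A ∨ D' = B := by
        intro D'
        have := congrArg (D' ∈ ·) hE
        simpa using this
      have hyA : y ∈ S A := (hmem A).2 (Or.inl rfl)
      have hyB : y ∈ S B := (hmem B).2 (Or.inr rfl)
      have hA : A ∈ T := h.closed D hD y hyD hy A hyA
      have hB : B ∈ T := h.closed D hD y hyD hy B hyB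
      have hd := h.alternating A hA B hB hAB y hyA hyB hy
      have h1 : T.filter (fun D => y ∈ S D) = {A, B} := by
        ext D'
        simp only [Finset.mem_filter, Finset.mem_insert, Finset.mem_singleton, hmem]
        constructor
        · exact fun h => h.2
        · rintro (rfl | rfl) <;> simp [*]
      have h2 : ∃ E, T.filter (fun D => y ∈ S D ∧ γ y ≠ d D) = {E} := by
        by_cases hgA : γ y = d A
        · refine ⟨B, ?_⟩
          ext D'
          simp only [Finset.mem_filter, Finset.mem_singleton, hmem]
          constructor
          · rintro ⟨_, rfl | rfl, h3⟩
            · exact absurd hgA h3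
            · rfl
          · rintro rfl
            exact ⟨hB, Or.inr rfl, by rw [hgA]; exact hd⟩
        · refine ⟨A, ?_⟩
          ext D'
          simp only [Finset.mem_filter, Finset.mem_singleton, hmem]
          constructor
          · rintro ⟨_, rfl | rfl, h3⟩
            · rfl
            · exfalso
              revert hgA hd h3
              cases γ y <;> cases d A <;> cases d D' <;> simp
          · rintro rfl
            exact ⟨hA, Or.inl rfl, hgA⟩
      obtain ⟨E, hE2⟩ := h2
      rw [h1, hE2, Finset.card_pair hAB, Finset.card_singleton]
    · push Not at hex
      rw [Finset.filter_eq_empty_iff.2 fun {D} hD => hex D hD,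
        Finset.filter_eq_empty_iff.2 fun {D} hD h' => hex D hD h'.1]
      simp
  have hcount := h.count
  rw [sum_card_inter_eq, Finset.sum_congr rfl hsplit, ← Finset.mul_sum] at hcount
  have hdc := Finset.sum_card_bipartiteAbove_eq_sum_card_bipartiteBelow
    (s := T) (t := U) (fun D y => y ∈ S D ∧ γ y ≠ d D)
  simp only [Finset.bipartiteAbove, Finset.bipartiteBelow] at hdc
  rw [← hdc] at hcount
  -- A variable of `D` with value other than `d D` must be free, since the fixed ones have value `d
  -- D`.
  have hle : ∑ D ∈ T, 1 ≤ ∑ D ∈ T, (U.filter (fun y => y ∈ S D ∧ γ y ≠ d D)).card := by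
    refine Finset.sum_le_sum fun D hD => ?_
    have : ∃ y ∈ S D, γ y ≠ d D := by
      obtain ⟨⟨y, hy, h1⟩, ⟨z, hz, h2⟩⟩ := hS D
      cases hdD : d D
      · exact ⟨y, hy, by simp [h1]⟩
      · exact ⟨z, hz, by simp [h2]⟩
    obtain ⟨y, hy, hne⟩ := this
    have hyU : y ∈ U := by
      by_contra hyU
      exact hne ((hγ y hyU).trans (h.fixed D hD y hy hyU))
    exact Finset.card_pos.2 ⟨y, by simp [hyU, hy, hne]⟩
  simp at hle hcount
  omega

/-- Removing a closed set of clauses that is not itself over-full. -/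
theorem Obstruction.sdiff {S : ι → Finset V} {U : Finset V} {α : V → Bool} {T N : Finset ι}
    {d : ι → Bool} (h : Obstruction S U α T d) (hN : N ⊆ T)
    (hclosed : ∀ D ∈ T, ∀ D' ∈ N, ∀ y ∈ S D, y ∈ S D' → y ∈ U → D ∈ N)
    (hcard : 2 * N.card ≤ ∑ D ∈ N, (U ∩ S D).card) : Obstruction S U α (T \ N) d where
  fixed D hD := h.fixed D (Finset.mem_sdiff.1 hD).1
  closed D hD y hy hyU D' hy' := by
    rw [Finset.mem_sdiff] at hD ⊢
    exact ⟨h.closed D hD.1 y hy hyU D' hy', fun hn => hD.2 (hclosed D hD.1 D' hn y hy hy' hyU)⟩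
  alternating D hD D' hD' :=
    h.alternating D (Finset.mem_sdiff.1 hD).1 D' (Finset.mem_sdiff.1 hD').1
  count := by
    have h1 := Finset.sum_sdiff (f := fun D => (U ∩ S D).card) hN
    have h2 := Finset.card_sdiff_add_card_eq_card hN
    have h3 := h.count
    omega

/-- An obstruction that does not involve the variable `x` does not depend on its being fixed. -/
theorem Obstruction.insert_of_notMem {S : ι → Finset V} {U : Finset V} {α : V → Bool}
    {T : Finset ι} {d : ι → Bool} {x : V} {b : Bool}
    (h : Obstruction S U (Function.update α x b) T d) (hx : ∀ D ∈ T, x ∉ S D) :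
    Obstruction S (insert x U) α T d where
  fixed D hD y hy hyU := by
    rw [Finset.mem_insert, not_or] at hyU
    rw [← h.fixed D hD y hy hyU.2, Function.update_of_ne hyU.1]
  closed D hD y hy hyU := by
    refine h.closed D hD y hy ((Finset.mem_insert.1 hyU).resolve_left ?_)
    rintro rfl
    exact hx D hD hy
  alternating D hD D' hD' hne y hy hy' hyU := by
    refine h.alternating D hD D' hD' hne y hy hy' ((Finset.mem_insert.1 hyU).resolve_left ?_)
    rintro rfl
    exact hx D hD hy
  count := by
    refine lt_of_le_of_lt (Finset.sum_le_sum fun D hD => ?_) h.count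
    rw [Finset.insert_inter_of_notMem (hx D hD)]

/-- Obstructions for the two values of `x` that agree where they meet combine into one in which
`x` is not fixed. -/
theorem Obstruction.union {S : ι → Finset V} {U : Finset V} {α : V → Bool} {T₀ T₁ : Finset ι}
    {d₀ d₁ : ι → Bool} {x : V} (hx : x ∉ U)
    (hU : ∀ y ∈ insert x U, (Finset.univ.filter (fun D => y ∈ S D)).card = 2)
    (h₀ : Obstruction S U (Function.update α x false) T₀ d₀)
    (h₁ : Obstruction S U (Function.update α x true) T₁ d₁)
    (hagree : ∀ D ∈ T₀, D ∈ T₁ → d₀ D = d₁ D) :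
    ∃ T d, Obstruction S (insert x U) α T d := by
  by_cases hx₀ : ∀ D ∈ T₀, x ∉ S D
  · exact ⟨_, _, h₀.insert_of_notMem hx₀⟩
  by_cases hx₁ : ∀ D ∈ T₁, x ∉ S D
  · exact ⟨_, _, h₁.insert_of_notMem hx₁⟩
  push Not at hx₀ hx₁
  have hd₀ : ∀ D ∈ T₀, x ∈ S D → d₀ D = false := fun D hD hxD => by
    rw [← h₀.fixed D hD x hxD hx, Function.update_self]
  have hd₁ : ∀ D ∈ T₁, x ∈ S D → d₁ D = true := fun D hD hxD => by
    rw [← h₁.fixed D hD x hxD hx, Function.update_self]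
  -- A clause through `x` takes the fixed value of `x` as its colour: `false` in `T₀`, `true` in
  -- `T₁`.
  have hdisj : ∀ D ∈ T₀, D ∈ T₁ → x ∉ S D := fun D hD hD' hxD => by
    have := hagree D hD hD'
    rw [hd₀ D hD hxD, hd₁ D hD' hxD] at this
    exact absurd this (by simp)
  obtain ⟨A, hA, hxA⟩ := hx₀
  obtain ⟨B, hB, hxB⟩ := hx₁
  have hA₁ : A ∉ T₁ := fun h => hdisj A hA h hxA
  have hB₀ : B ∉ T₀ := fun h => hdisj B h hB hxB
  have hAB : A ≠ B := by
    rintro rfl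
    exact hB₀ hA
  have hcontain : ∀ D, x ∈ S D → D = A ∨ D = B := by
    have h2 : ({A, B} : Finset ι) = Finset.univ.filter (fun D => x ∈ S D) := by
      refine Finset.eq_of_subset_of_card_le ?_ ?_
      · intro D
        simp only [Finset.mem_insert, Finset.mem_singleton, Finset.mem_filter, Finset.mem_univ,
          true_and]
        rintro (rfl | rfl) <;> assumption
      · rw [hU x (Finset.mem_insert_self _ _), Finset.card_pair hAB]
    intro D hD
    have : D ∈ ({A, B} : Finset ι) := by
      rw [h2]
      simpa using hD
    simpa using this
  -- The intersection is closed and avoids `x`. If it has few edges it is already an obstruction;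
  -- otherwise it can be cut out of `T₁`, which makes the two pieces disjoint.
  by_cases hI : ∑ D ∈ T₀ ∩ T₁, (U ∩ S D).card < 2 * (T₀ ∩ T₁).card
  · refine ⟨T₀ ∩ T₁, d₀, Obstruction.insert_of_notMem (b := false)
      ⟨?_, ?_, ?_, hI⟩ ?_⟩
    · exact fun D hD => h₀.fixed D (Finset.mem_inter.1 hD).1
    · intro D hD y hy hyU D' hy'
      rw [Finset.mem_inter] at hD ⊢
      exact ⟨h₀.closed D hD.1 y hy hyU D' hy', h₁.closed D hD.2 y hy hyU D' hy'⟩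
    · exact fun D hD D' hD' => h₀.alternating D (Finset.mem_inter.1 hD).1 D'
        (Finset.mem_inter.1 hD').1
    · exact fun D hD => hdisj D (Finset.mem_inter.1 hD).1 (Finset.mem_inter.1 hD).2
  have h₁' : Obstruction S U (Function.update α x true) (T₁ \ (T₀ ∩ T₁)) d₁ := by
    refine h₁.sdiff Finset.inter_subset_right ?_ (not_lt.1 hI)
    intro D hD D' hD' y hy hy' hyU
    rw [Finset.mem_inter] at hD' ⊢
    exact ⟨h₀.closed D' hD'.1 y hy' hyU D hy, hD⟩
  have hsd : T₁ \ (T₀ ∩ T₁) = T₁ \ T₀ := by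
    ext D
    simp only [Finset.mem_sdiff, Finset.mem_inter]
    tauto
  rw [hsd] at h₁'
  refine ⟨T₀ ∪ T₁, fun D => if D ∈ T₀ then d₀ D else d₁ D, ?_, ?_, ?_, ?_⟩
  · intro D hD y hy hyU
    rw [Finset.mem_insert, not_or] at hyU
    by_cases hD₀ : D ∈ T₀
    · simp only [hD₀, if_true]
      rw [← h₀.fixed D hD₀ y hy hyU.2, Function.update_of_ne hyU.1]
    · simp only [hD₀, if_false]
      rw [← h₁.fixed D ((Finset.mem_union.1 hD).resolve_left hD₀) y hy hyU.2,
        Function.update_of_ne hyU.1]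
  · intro D hD y hy hyU D' hy'
    rw [Finset.mem_union] at hD ⊢
    rcases Finset.mem_insert.1 hyU with rfl | hyU
    · rcases hcontain D' hy' with rfl | rfl
      · exact Or.inl hA
      · exact Or.inr hB
    · exact hD.imp (fun h => h₀.closed D h y hy hyU D' hy')
        (fun h => h₁.closed D h y hy hyU D' hy')
  · intro D hD D' hD' hne y hy hy' hyU
    rcases Finset.mem_insert.1 hyU with rfl | hyU
    · rcases hcontain D hy with rfl | rfl <;> rcases hcontain D' hy' with rfl | rfl
      · exact absurd rfl hne
      · simp [hA, hB₀, hd₀ _ hA hxA, hd₁ _ hB hxB]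
      · simp [hA, hB₀, hd₀ _ hA hxA, hd₁ _ hB hxB]
      · exact absurd rfl hne
    · by_cases hD₀ : D ∈ T₀
      · have hD₀' := h₀.closed D hD₀ y hy hyU D' hy'
        simp only [hD₀, hD₀', if_true]
        exact h₀.alternating D hD₀ D' hD₀' hne y hy hy' hyU
      · have hD₀' : D' ∉ T₀ := fun h => hD₀ (h₀.closed D' h y hy' hyU D hy)
        simp only [hD₀, hD₀', if_false]
        exact h₁.alternating D ((Finset.mem_union.1 hD).resolve_left hD₀) D'
          ((Finset.mem_union.1 hD').resolve_left hD₀') hne y hy hy' hyU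
  · have hU' : ∀ y ∈ U, (Finset.univ.filter (fun D => y ∈ S D)).card = 2 :=
      fun y hy => hU y (Finset.mem_insert_of_mem hy)
    -- By parity each strict inequality has slack at least 2, so the two have slack 4 together,
    -- while freeing `x` costs at most 2.
    obtain ⟨a, ha⟩ := even_sum_card_inter hU' h₀.closed
    obtain ⟨b, hb⟩ := even_sum_card_inter hU' h₁'.closed
    have hc₀ := h₀.count
    have hc₁ := h₁'.count
    have hun : T₀ ∪ T₁ = T₀ ∪ T₁ \ T₀ := Finset.union_sdiff_self_eq_union.symm
    have hdj : Disjoint T₀ (T₁ \ T₀) := Finset.disjoint_sdiff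
    have hcard : (T₀ ∪ T₁).card = T₀.card + (T₁ \ T₀).card := by
      rw [hun, Finset.card_union_of_disjoint hdj]
    have hsum : ∑ D ∈ T₀ ∪ T₁, (U ∩ S D).card
        = ∑ D ∈ T₀, (U ∩ S D).card + ∑ D ∈ T₁ \ T₀, (U ∩ S D).card := by
      rw [hun, Finset.sum_union hdj]
    have hins : ∑ D ∈ T₀ ∪ T₁, ((insert x U) ∩ S D).card
        = ((T₀ ∪ T₁).filter (fun D => x ∈ S D)).card + ∑ D ∈ T₀ ∪ T₁, (U ∩ S D).card := by
      rw [sum_card_inter_eq, Finset.sum_insert hx, sum_card_inter_eq]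
    have hle : ((T₀ ∪ T₁).filter (fun D => x ∈ S D)).card ≤ 2 := by
      rw [← hU x (Finset.mem_insert_self _ _)]
      exact Finset.card_le_card (Finset.filter_subset_filter _ (Finset.subset_univ _))
    omega

/-- A clause on which the colours disagree can contain no fixed variable except `x`, so at least two
of its three variables are free. The set `N` of such clauses therefore has enough edges to be
removed from both obstructions. -/
theorem exists_obstruction_of_update {S : ι → Finset V} {U : Finset V} {α : V → Bool}
    {T₀ T₁ : Finset ι} {d₀ d₁ : ι → Bool} {x : V} (hx : x ∉ U) (hS : ∀ D, (S D).card = 3)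
    (hU : ∀ y ∈ insert x U, (Finset.univ.filter (fun D => y ∈ S D)).card = 2)
    (h₀ : Obstruction S U (Function.update α x false) T₀ d₀)
    (h₁ : Obstruction S U (Function.update α x true) T₁ d₁) :
    ∃ T d, Obstruction S (insert x U) α T d := by
  set N := (T₀ ∩ T₁).filter (fun D => d₀ D ≠ d₁ D) with hN
  have hmem : ∀ D, D ∈ N ↔ D ∈ T₀ ∧ D ∈ T₁ ∧ d₀ D ≠ d₁ D := by
    intro D
    simp [hN, and_assoc]
  have hcard : 2 * N.card ≤ ∑ D ∈ N, (U ∩ S D).card := by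
    have : ∑ D ∈ N, 2 ≤ ∑ D ∈ N, (U ∩ S D).card := by
      refine Finset.sum_le_sum fun D hD => ?_
      obtain ⟨hD₀, hD₁, hne⟩ := (hmem D).1 hD
      have hsub : (S D).erase x ⊆ U ∩ S D := by
        intro y hy
        rw [Finset.mem_erase] at hy
        rw [Finset.mem_inter]
        refine ⟨?_, hy.2⟩
        by_contra hyU
        have e₀ := h₀.fixed D hD₀ y hy.2 hyU
        have e₁ := h₁.fixed D hD₁ y hy.2 hyU
        rw [Function.update_of_ne hy.1] at e₀ e₁
        exact hne (e₀.symm.trans e₁)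
      have h1 := Finset.card_le_card hsub
      have h2 := Finset.pred_card_le_card_erase (s := S D) (a := x)
      rw [hS D] at h2
      omega
    simpa [mul_comm] using this
  -- Both colourings flip along an edge, so disagreement propagates to neighbours.
  have key : ∀ D ∈ T₀, D ∈ T₁ → ∀ D' ∈ N, ∀ y ∈ S D, y ∈ S D' → y ∈ U → D ∈ N := by
    intro D hD₀ hD₁ D' hD' y hy hy' hyU
    by_cases hDD : D = D'
    · rwa [hDD]
    obtain ⟨hD₀', hD₁', hne⟩ := (hmem D').1 hD'
    refine (hmem D).2 ⟨hD₀, hD₁, ?_⟩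
    have e₀ := h₀.alternating D hD₀ D' hD₀' hDD y hy hy' hyU
    have e₁ := h₁.alternating D hD₁ D' hD₁' hDD y hy hy' hyU
    revert hne e₀ e₁
    cases d₀ D <;> cases d₁ D <;> cases d₀ D' <;> cases d₁ D' <;> simp
  refine Obstruction.union hx hU
    (h₀.sdiff (fun D hD => ((hmem D).1 hD).1) (fun D hD D' hD' y hy hy' hyU => ?_) hcard)
    (h₁.sdiff (fun D hD => ((hmem D).1 hD).2.1) (fun D hD D' hD' y hy hy' hyU => ?_) hcard) ?_
  · exact key D hD (h₁.closed D' ((hmem D').1 hD').2.1 y hy' hyU D hy) D' hD' y hy hy' hyU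
  · exact key D (h₀.closed D' ((hmem D').1 hD').1 y hy' hyU D hy) hD D' hD' y hy hy' hyU
  · intro D hD₀ hD₁
    rw [Finset.mem_sdiff] at hD₀ hD₁
    by_contra hne
    exact hD₀.2 ((hmem D).2 ⟨hD₀.1, hD₁.1, hne⟩)

/-- Without an obstruction, an assignment of the variables outside `U` extends to one that
nae-satisfies all clauses, provided that each variable in `U` lies in exactly two clauses. -/
theorem exists_naeFamily_or_obstruction {S : ι → Finset V} (hS : ∀ D, (S D).card = 3)
    (U : Finset V) (hU : ∀ y ∈ U, (Finset.univ.filter (fun D => y ∈ S D)).card = 2)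
    (α : V → Bool) :
    (∃ γ : V → Bool, (∀ y ∉ U, γ y = α y) ∧ NAEFamily S γ) ∨ ∃ T d, Obstruction S U α T d := by
  induction U using Finset.induction_on generalizing α with
  | empty =>
    by_cases h : NAEFamily S α
    · exact Or.inl ⟨α, fun _ _ => rfl, h⟩
    · right
      simp only [NAEFamily, not_forall] at h
      obtain ⟨D, hD⟩ := h
      have : ∃ b, ∀ y ∈ S D, α y = b := by
        by_cases h1 : ∃ y ∈ S D, α y = true
        · exact ⟨true, fun y hy => by
            by_contra h2
            exact hD ⟨h1, y, hy, by simpa using h2⟩⟩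
        · push Not at h1
          exact ⟨false, fun y hy => by simpa using h1 y hy⟩
      obtain ⟨b, hb⟩ := this
      -- With nothing free, a monochromatic clause alone is an obstruction: an isolated vertex
      -- without edges.
      refine ⟨{D}, fun _ => b, ?_, ?_, ?_, ?_⟩
      · simpa using hb
      · simp
      · simp
      · simp
  | insert x U hx ih =>
    have hU' : ∀ y ∈ U, (Finset.univ.filter (fun D => y ∈ S D)).card = 2 :=
      fun y hy => hU y (Finset.mem_insert_of_mem hy)
    have lift : ∀ b, (∃ γ : V → Bool, (∀ y ∉ U, γ y = Function.update α x b y) ∧ NAEFamily S γ) →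
        ∃ γ : V → Bool, (∀ y ∉ insert x U, γ y = α y) ∧ NAEFamily S γ := by
      rintro b ⟨γ, hγ, hs⟩
      refine ⟨γ, fun y hy => ?_, hs⟩
      rw [Finset.mem_insert, not_or] at hy
      rw [hγ y hy.2, Function.update_of_ne hy.1]
    rcases ih hU' (Function.update α x false) with h | ⟨T₀, d₀, h₀⟩
    · exact Or.inl (lift _ h)
    rcases ih hU' (Function.update α x true) with h | ⟨T₁, d₁, h₁⟩
    · exact Or.inl (lift _ h)
    exact Or.inr (exists_obstruction_of_update hx hS hU h₀ h₁)

end Obstruction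

/-! ### The verifier as a multi-stack machine -/

section Machine

/-- Tape symbols: the unary digit, and the terminators of numerals.  A terminator is dead if its
numeral has been exhausted; it records whether the numeral is the first one of its clause, and the
colour of that clause (`none` if the clause is uncoloured). -/
inductive Sym
  | one
  | term (first : Bool) (colour : Option Bool)
  | dead (first : Bool) (colour : Option Bool)
  deriving DecidableEq, Fintype

/-- The kind of variable that is treated in the current pass. -/
inductive Mode
  | univ
  | exist
  | final
  deriving DecidableEq

instance : Fintype Mode where
  elems := {.univ, .exist, .final}
  complete := by rintro (_ | _ | _) <;> simp

/-- The position of the head relative to the numerals of the tape during a pass. -/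
inductive Head
  | start
  | inUniv
  | startExist
  | inExist
  | token
  | inToken
  deriving DecidableEq

instance : Fintype Head where
  elems := {.start, .inUniv, .startExist, .inExist, .token, .inToken}
  complete := by rintro (_ | _ | _ | _ | _ | _) <;> simp

/-- The phases: `read` moves the formula to `left`, in reverse; `merge` moves it to `right` and
attaches the colours from the certificate; `scan` and `rewind` alternate, one pass per variable and
a final one; `clear` empties the stacks and outputs. -/
inductive Label
  | read
  | merge
  | scan
  | rewind
  | clear
  deriving DecidableEq

instance : Fintype Label where
  elems := {.read, .merge, .scan, .rewind, .clear}
  complete := by rintro (_ | _ | _ | _ | _) <;> simp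

/-- `left` and `right` are the two halves of a tape around the head. `marks` is a unary counter,
initially the number of coloured clauses (plus one if the header is coloured), and finally receives
the output. -/
inductive Stack
  | inp
  | left
  | right
  | marks
  deriving DecidableEq

instance : Fintype Stack where
  elems := {.inp, .left, .right, .marks}
  complete := by rintro (_ | _ | _ | _) <;> simp

/-- What is recorded about the current variable during a pass: its number of appearances (up to
saturation), the colours of the clauses in which it appears, whether it appears in the current
clause, whether it appears twice in some clause, and whether some numeral is not yet exhausted. -/
@[ext] structure Tally (s : ℕ) where
  total : Fin (s + 3) := 0
  seen : Option Bool → Bool := fun _ => false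
  inClause : Bool := false
  dup : Bool := false
  alive : Bool := false
  deriving DecidableEq, Fintype

structure Reg (s : ℕ) where
  inSym : Option (Option Bool) := none
  sym : Option Sym := none
  bit : Option Bool := none
  -- With this default the empty string counts as not ending in a terminator, hence as malformed.
  last : Bool := true
  pos : Fin 3 := 0
  colour : Option Bool := none
  head : Head := .start
  mode : Mode := .univ
  tally : Tally s := {}
  invalid : Bool := false
  bad : Bool := false
  under : Bool := false
  verdict : Bool := false
  empty : Bool := false
  deriving DecidableEq

noncomputable instance (s : ℕ) : Fintype (Reg s) :=
  Fintype.ofInjective (fun v : Reg s =>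
      ((v.inSym, v.sym, v.bit, v.last, v.pos, v.colour),
        (v.head, v.mode, v.tally, v.invalid, v.bad, v.under, v.verdict, v.empty))) <| by
    rintro ⟨⟩ ⟨⟩ h
    simp only [Prod.mk.injEq] at h
    simp [h]


variable {s : ℕ}

/-- The ceiling `s + 2` exceeds both `s` and, for positive `s`, the number 2, so saturation never
hides a wrong count. -/
def Tally.satSucc (t : Fin (s + 3)) : Fin (s + 3) := ⟨min (t + 1) (s + 2), by omega⟩

/-- The effect on the tally of reading the terminator of a numeral. -/
def Tally.event (first : Bool) (c : Option Bool) (hit alive : Bool) (t : Tally s) : Tally s where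
  total := if hit then satSucc t.total else t.total
  seen := if hit then Function.update t.seen c true else t.seen
  inClause := if first then hit else t.inClause || hit
  dup := t.dup || (!first && t.inClause && hit)
  alive := t.alive || alive

/-- The colour that is encoded by two bits of the certificate. -/
def colourOf : Option Bool → Option Bool → Option Bool
  | some true, some true => some true
  | some true, _ => some false
  | _, _ => none

def StackAlphabet : Stack → Type
  | .inp => Option Bool
  | .left => Sym
  | .right => Sym
  | .marks => Bool

abbrev VStmt (s : ℕ) := TM2.Stmt StackAlphabet Label (Reg s)

def popInp (f : Reg s → Option (Option Bool) → Reg s) (q : VStmt s) : VStmt s := .pop .inp f q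

def popLeft (f : Reg s → Option Sym → Reg s) (q : VStmt s) : VStmt s := .pop .left f q

def pushLeft (f : Reg s → Sym) (q : VStmt s) : VStmt s := .push .left f q

def popRight (f : Reg s → Option Sym → Reg s) (q : VStmt s) : VStmt s := .pop .right f q

def pushRight (f : Reg s → Sym) (q : VStmt s) : VStmt s := .push .right f q

def popMarks (f : Reg s → Option Bool → Reg s) (q : VStmt s) : VStmt s := .pop .marks f q

def pushMarks (f : Reg s → Bool) (q : VStmt s) : VStmt s := .push .marks f q

def readSym (v : Reg s) : Sym :=
  match v.inSym with
  | some (some true) => .one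
  | _ => .term false none

def readStmt : VStmt s :=
  popInp (fun v a => { v with inSym := a }) <|
  .branch (fun v => v.inSym.join.isSome)
    (pushLeft readSym <|
      .load (fun v => { v with last := v.inSym.join.getD true, inSym := none }) <|
      .goto fun _ => .read)
    (.load (fun v => { v with verdict := v.last, inSym := none }) <|
      .goto fun v => if v.last then .clear else .merge)

def mergeEmit : VStmt s :=
  pushRight (fun v => .term (v.pos = 2) v.colour) <|
  .load (fun v => { v with pos := v.pos + 1, sym := none, bit := none }) <|
  .goto fun _ => .merge

/-- The formula is met from its end, so `pos = 0` marks the last numeral of a clause, where two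
certificate bits are consumed, and `pos = 2` the first. The two header numerals, met last, leave
`pos = 2` in a well-formed string; any other value leads to acceptance. -/
def mergeStmt : VStmt s :=
  popLeft (fun v a => { v with sym := a }) <|
  .branch (fun v => v.sym.isNone)
    (.load (fun v => { v with verdict := decide (v.pos ≠ 2), colour := none }) <|
      .goto fun v => if v.verdict then .clear else .scan)
    (.branch (fun v => v.sym = some .one)
      (pushRight (fun _ => .one) <|
        .load (fun v => { v with sym := none }) <|
        .goto fun _ => .merge)
      (.branch (fun v => v.pos = 0)
        (popInp (fun v a => { v with bit := Option.join a }) <|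
          popInp (fun v a => { v with colour := colourOf v.bit (Option.join a) }) <|
          .branch (fun v => v.colour.isSome) (pushMarks (fun _ => true) mergeEmit) mergeEmit)
        mergeEmit))

def popsMark (v : Reg s) : Bool :=
  match v.head, v.mode, v.sym with
  | .token, .univ, some (.term _ (some _)) => true
  | _, _, _ => false

/-- The three symbols that are not copied are the decrements: of one header counter, and of each
numeral not yet exhausted. -/
def emits (v : Reg s) : Bool :=
  match v.head, v.sym with
  | .start, some .one => false
  | .startExist, some .one => false
  | .token, some .one => false
  | _, _ => true

def emitSym (v : Reg s) : Sym :=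
  match v.head, v.sym with
  | .token, some (.term f c) => .dead f c
  | _, some a => a
  | _, none => .one

def scanUpdate (v : Reg s) : Reg s :=
  match v.head, v.sym with
  | .start, some .one => { v with head := .inUniv, mode := .univ, sym := none }
  -- No universal variable is left. The mode is provisional: it becomes `exist` if a digit follows
  -- in the second counter.
  | .start, _ => { v with head := .startExist, mode := .final, sym := none }
  | .inUniv, some .one => { v with sym := none }
  | .inUniv, _ => { v with head := .inExist, sym := none }
  | .startExist, some .one => { v with head := .inExist, mode := .exist, sym := none }
  | .startExist, _ => { v with head := .token, sym := none }
  | .inExist, some .one => { v with sym := none }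
  | .inExist, _ => { v with head := .token, sym := none }
  | .token, some .one => { v with head := .inToken, sym := none }
  | .token, some (.term f c) => { v with tally := v.tally.event f c true true, sym := none }
  | .token, some (.dead f c) => { v with tally := v.tally.event f c false false, sym := none }
  | .inToken, some (.term f c) =>
    { v with head := .token, tally := v.tally.event f c false true, sym := none }
  | _, _ => { v with sym := none }

/-- Whether the recorded appearances of an existential variable are all in uncoloured clauses, or in
clauses of both colours. -/
def Tally.existOK (t : Tally s) : Bool :=
  (!t.seen (some true) && !t.seen (some false)) ||
    (!t.seen none && t.seen (some true) && t.seen (some false))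

def endPass (v : Reg s) : Reg s :=
  match v.mode with
  | .univ =>
    { v with
      sym := none
      head := .start
      tally := {}
      invalid := v.invalid || decide (v.tally.total.val ≠ s) || v.tally.dup
      bad := v.bad || (v.tally.seen (some true) && v.tally.seen (some false)) }
  | .exist =>
    { v with
      sym := none
      head := .start
      tally := {}
      invalid := v.invalid || decide (v.tally.total.val ≠ 2) || v.tally.dup
      bad := v.bad || !v.tally.existOK }
  | .final =>
    { v with
      sym := none
      -- A numeral still alive once all variables are used up is an index out of range.
      verdict := v.invalid || v.tally.alive || (!v.bad && v.under) }

def scanFinish : VStmt s := .load scanUpdate <| .goto fun _ => .scan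

def scanEmit : VStmt s := .branch emits (pushLeft emitSym scanFinish) scanFinish

def scanStmt : VStmt s :=
  popRight (fun v a => { v with sym := a }) <|
  .branch (fun v => v.sym.isNone)
    (.load endPass <| .goto fun v => if v.mode = .final then .clear else .rewind)
    (.branch popsMark
      (popMarks (fun v a => { v with under := v.under || a.isNone }) scanEmit) scanEmit)

def rewindStmt : VStmt s :=
  popLeft (fun v a => { v with sym := a }) <|
  .branch (fun v => v.sym.isNone)
    (.goto fun _ => .scan)
    (pushRight (fun v => v.sym.getD .one) <|
      .load (fun v => { v with sym := none }) <|
      .goto fun _ => .rewind)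

/-- The registers are reset because a halting configuration must carry the initial state. -/
def outputStmt (b : Bool) : VStmt s :=
  pushMarks (fun _ => b) <| .load (fun _ => {}) .halt

def clearStmt : VStmt s :=
  popInp (fun v a => { v with empty := a.isNone }) <|
  popLeft (fun v a => { v with empty := v.empty && a.isNone }) <|
  popRight (fun v a => { v with empty := v.empty && a.isNone }) <|
  popMarks (fun v a => { v with empty := v.empty && a.isNone }) <|
  .branch (fun v => v.empty)
    (.branch (fun v => v.verdict) (outputStmt true) (outputStmt false))
    (.goto fun _ => .clear)

def prog (s : ℕ) : Label → VStmt s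
  | .read => readStmt
  | .merge => mergeStmt
  | .scan => scanStmt
  | .rewind => rewindStmt
  | .clear => clearStmt

noncomputable def verifier (s : ℕ) : FinTM2 where
  K := Stack
  k₀ := .inp
  k₁ := .marks
  Γ := StackAlphabet
  Λ := Label
  main := .read
  σ := Reg s
  initialState := {}
  Γk₀Fin := inferInstanceAs (Fintype (Option Bool))
  m := prog s

def contents (i : List (Option Bool)) (l r : List Sym) (m : List Bool) :
    ∀ k, List (StackAlphabet k)
  | .inp => i
  | .left => l
  | .right => r
  | .marks => m

abbrev VCfg (s : ℕ) := TM2.Cfg StackAlphabet Label (Reg s)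

def cfg (L : Label) (v : Reg s) (i : List (Option Bool)) (l r : List Sym) (m : List Bool) :
    VCfg s :=
  ⟨some L, v, contents i l r m⟩

/-- The result of executing a statement. -/
def exec (q : VStmt s) (v : Reg s) (i : List (Option Bool)) (l r : List Sym) (m : List Bool) :
    VCfg s :=
  TM2.stepAux q v (contents i l r m)

@[simp] theorem exec_pop_inp (f : Reg s → Option (Option Bool) → Reg s) (q : VStmt s) (v : Reg s)
    (i : List (Option Bool)) (l r : List Sym) (m : List Bool) :
    exec (popInp f q) v i l r m =
      exec q (f v i.head?) i.tail l r m := by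
  refine congrArg (TM2.stepAux q _) ?_
  funext k; cases k <;> rfl

@[simp] theorem exec_pop_left (f : Reg s → Option Sym → Reg s) (q : VStmt s) (v : Reg s)
    (i : List (Option Bool)) (l r : List Sym) (m : List Bool) :
    exec (popLeft f q) v i l r m =
      exec q (f v l.head?) i l.tail r m := by
  refine congrArg (TM2.stepAux q _) ?_
  funext k; cases k <;> rfl

@[simp] theorem exec_push_left (f : Reg s → Sym) (q : VStmt s) (v : Reg s)
    (i : List (Option Bool)) (l r : List Sym) (m : List Bool) :
    exec (pushLeft f q) v i l r m =
      exec q v i (f v :: l) r m := by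
  refine congrArg (TM2.stepAux q _) ?_
  funext k; cases k <;> rfl

@[simp] theorem exec_pop_right (f : Reg s → Option Sym → Reg s) (q : VStmt s) (v : Reg s)
    (i : List (Option Bool)) (l r : List Sym) (m : List Bool) :
    exec (popRight f q) v i l r m =
      exec q (f v r.head?) i l r.tail m := by
  refine congrArg (TM2.stepAux q _) ?_
  funext k; cases k <;> rfl

@[simp] theorem exec_push_right (f : Reg s → Sym) (q : VStmt s) (v : Reg s)
    (i : List (Option Bool)) (l r : List Sym) (m : List Bool) :
    exec (pushRight f q) v i l r m =
      exec q v i l (f v :: r) m := by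
  refine congrArg (TM2.stepAux q _) ?_
  funext k; cases k <;> rfl

@[simp] theorem exec_pop_marks (f : Reg s → Option Bool → Reg s) (q : VStmt s) (v : Reg s)
    (i : List (Option Bool)) (l r : List Sym) (m : List Bool) :
    exec (popMarks f q) v i l r m =
      exec q (f v m.head?) i l r m.tail := by
  refine congrArg (TM2.stepAux q _) ?_
  funext k; cases k <;> rfl

@[simp] theorem exec_push_marks (f : Reg s → Bool) (q : VStmt s) (v : Reg s)
    (i : List (Option Bool)) (l r : List Sym) (m : List Bool) :
    exec (pushMarks f q) v i l r m =
      exec q v i l r (f v :: m) := by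
  refine congrArg (TM2.stepAux q _) ?_
  funext k; cases k <;> rfl

@[simp] theorem exec_load (f : Reg s → Reg s) (q : VStmt s) (v : Reg s) (i l r m) :
    exec (.load f q) v i l r m = exec q (f v) i l r m := rfl

@[simp] theorem exec_branch (f : Reg s → Bool) (q₁ q₂ : VStmt s) (v : Reg s) (i l r m) :
    exec (.branch f q₁ q₂) v i l r m =
      if f v = true then exec q₁ v i l r m else exec q₂ v i l r m :=
  Bool.cond_eq_ite _ _ _

@[simp] theorem exec_goto (f : Reg s → Label) (v : Reg s) (i l r m) :
    exec (.goto f) v i l r m = cfg (f v) v i l r m := rfl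

/-- The machine gets from `a` to `b` in at most `n` steps. -/
def Within (s n : ℕ) (a b : VCfg s) : Prop :=
  ∃ k ≤ n, (flip bind (TM2.step (prog s)))^[k] (some a) = some b

theorem Within.refl (a : VCfg s) : Within s 0 a a := ⟨0, le_rfl, rfl⟩

theorem Within.mono {n n' : ℕ} {a b : VCfg s} (h : Within s n a b) (hn : n ≤ n') :
    Within s n' a b :=
  let ⟨k, hk, h'⟩ := h
  ⟨k, hk.trans hn, h'⟩

theorem Within.trans {n n' : ℕ} {a b c : VCfg s} (h : Within s n a b) (h' : Within s n' b c) :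
    Within s (n + n') a c := by
  obtain ⟨k, hk, e⟩ := h
  obtain ⟨k', hk', e'⟩ := h'
  exact ⟨k' + k, by omega, by rw [Function.iterate_add_apply, e, e']⟩

theorem Within.of_step {L : Label} {v : Reg s} {i l r m} {b : VCfg s}
    (h : exec (prog s L) v i l r m = b) : Within s 1 (cfg L v i l r m) b :=
  ⟨1, le_rfl, congrArg some h⟩

end Machine

/-! ### Step bounds for reading, merging, rewinding and clearing -/

section Runs

variable {s : ℕ}

def bitSym (b : Bool) : Sym := if b then .one else .term false none

theorem within_read (x : List Bool) (j : List (Option Bool)) (v : Reg s) (hv : v.inSym = none)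
    (l r : List Sym) (m : List Bool) :
    Within s x.length (cfg .read v (x.map some ++ j) l r m)
      (cfg .read { v with last := x.getLastD v.last } j ((x.map bitSym).reverse ++ l) r m) := by
  induction x generalizing v l with
  | nil => exact Within.refl _
  | cons b x ih =>
    have h1 : Within s 1 (cfg .read v ((b :: x).map some ++ j) l r m)
        (cfg .read { v with last := b } (x.map some ++ j) (bitSym b :: l) r m) := by
      apply Within.of_step
      cases b <;> simp [prog, readStmt, readSym, bitSym, hv]
    have h2 := (h1.trans (ih { v with last := b } hv _)).mono (Nat.add_comm 1 x.length).le
    rw [List.getLastD_cons]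
    simpa [-List.getLastD_eq_getLast?] using h2

theorem within_read_end (c : List (Option Bool)) (v : Reg s) (hv : v.inSym = none)
    (l r : List Sym) (m : List Bool) :
    Within s 1 (cfg .read v (none :: c) l r m)
      (cfg (if v.last then .clear else .merge) { v with verdict := v.last } c l r m) := by
  apply Within.of_step
  simp [prog, readStmt, hv]


theorem merge_one (v : Reg s) (hv : v.sym = none) (i l r m) :
    Within s 1 (cfg .merge v i (.one :: l) r m) (cfg .merge v i l (.one :: r) m) := by
  apply Within.of_step
  simp [prog, mergeStmt, ← hv]

theorem merge_ones (v : Reg s) (hv : v.sym = none) (k : ℕ) (i l r m) :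
    Within s k (cfg .merge v i (List.replicate k .one ++ l) r m)
      (cfg .merge v i l (List.replicate k .one ++ r) m) := by
  induction k generalizing r with
  | zero => exact Within.refl _
  | succ k ih =>
    have h := ((merge_one v hv i (List.replicate k .one ++ l) r m).trans (ih _)).mono
      (Nat.add_comm 1 k).le
    rw [List.replicate_succ', List.append_assoc, List.append_assoc, List.singleton_append]
    rwa [← List.singleton_append, ← List.append_assoc, ← List.replicate_succ',
      List.replicate_succ] at *

theorem merge_term (v : Reg s) (hs : v.sym = none) (hb : v.bit = none) (hp : v.pos ≠ 0) (f c)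
    (i l r m) :
    Within s 1 (cfg .merge v i (.term f c :: l) r m)
      (cfg .merge { v with pos := v.pos + 1 } i l (.term (v.pos = 2) v.colour :: r) m) := by
  apply Within.of_step
  simp [prog, mergeStmt, mergeEmit, hs, hb, hp]

theorem merge_term_zero (v : Reg s) (hs : v.sym = none) (hb : v.bit = none) (hp : v.pos = 0) (f c)
    (c' : List Bool) (l r m) :
    Within s 1 (cfg .merge v (c'.map some) (.term f c :: l) r m)
      (cfg .merge { v with pos := 1, colour := colourOf c'.head? c'.tail.head? }
        (c'.tail.tail.map some) l (.term false (colourOf c'.head? c'.tail.head?) :: r)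
        (List.replicate (colourOf c'.head? c'.tail.head?).toList.length true ++ m)) := by
  apply Within.of_step
  rcases c' with _ | ⟨a, _ | ⟨b, c'⟩⟩
  · simp [prog, mergeStmt, mergeEmit, hs, hb, hp, colourOf]
  · cases a <;> simp [prog, mergeStmt, mergeEmit, hs, hb, hp, colourOf]
  · cases a <;> cases b <;> simp [prog, mergeStmt, mergeEmit, hs, hb, hp, colourOf]

theorem merge_end (v : Reg s) (i r m) :
    Within s 1 (cfg .merge v i [] r m)
      (cfg (if v.pos = 2 then .scan else .clear)
        { v with sym := none, verdict := decide (v.pos ≠ 2), colour := none } i [] r m) := by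
  apply Within.of_step
  by_cases h : v.pos = 2 <;> simp [prog, mergeStmt, h]

theorem within_rewind (l : List Sym) (v : Reg s) (hv : v.sym = none) (i r m) :
    Within s (l.length + 1) (cfg .rewind v i l r m) (cfg .scan v i [] (l.reverse ++ r) m) := by
  induction l generalizing r with
  | nil =>
    apply Within.of_step
    simp [prog, rewindStmt, ← hv]
  | cons a l ih =>
    have h : Within s 1 (cfg .rewind v i (a :: l) r m) (cfg .rewind v i l (a :: r) m) := by
      apply Within.of_step
      simp [prog, rewindStmt, ← hv]
    simpa [Nat.add_comm] using h.trans (ih _)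

/-- The halting configuration with output `b`. -/
def outCfg (s : ℕ) (b : Bool) : VCfg s := ⟨none, {}, contents [] [] [] [b]⟩

theorem exec_outputStmt (b : Bool) (v : Reg s) :
    exec (outputStmt b) v [] [] [] [] = outCfg s b := by
  simp [outputStmt]
  rfl

/-- One step pops all four stacks, so the longest of them bounds the time. -/
theorem within_clear (n : ℕ) (v : Reg s) (i l r m) (hi : i.length ≤ n) (hl : l.length ≤ n)
    (hr : r.length ≤ n) (hm : m.length ≤ n) :
    Within s (n + 1) (cfg .clear v i l r m) (outCfg s v.verdict) := by
  by_cases h : i = [] ∧ l = [] ∧ r = [] ∧ m = []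
  · obtain ⟨rfl, rfl, rfl, rfl⟩ := h
    refine Within.mono (Within.of_step ?_) (Nat.le_add_left 1 n)
    cases hv : v.verdict <;> simp [prog, clearStmt, hv, exec_outputStmt]
  · induction n generalizing v i l r m with
    | zero => simp_all
    | succ n ih =>
      have h1 : ∃ e, Within s 1 (cfg .clear v i l r m)
          (cfg .clear { v with empty := e } i.tail l.tail r.tail m.tail) := by
        refine ⟨false, Within.of_step ?_⟩
        rw [← List.head?_eq_none_iff (l := i), ← List.head?_eq_none_iff (l := l),
          ← List.head?_eq_none_iff (l := r), ← List.head?_eq_none_iff (l := m)] at h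
        cases hi : i.head? <;> cases hl : l.head? <;> cases hr : r.head? <;> cases hm : m.head? <;>
          simp_all [prog, clearStmt]
      obtain ⟨e, h1⟩ := h1
      rw [add_comm]
      refine h1.trans ?_
      by_cases h2 : i.tail = [] ∧ l.tail = [] ∧ r.tail = [] ∧ m.tail = []
      · rw [h2.1, h2.2.1, h2.2.2.1, h2.2.2.2]
        refine Within.mono (Within.of_step ?_) (Nat.le_add_left 1 n)
        cases hv : v.verdict <;> simp [prog, clearStmt, exec_outputStmt]
      · refine ih { v with empty := e } _ _ _ _ ?_ ?_ ?_ ?_ h2 <;>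
          rw [List.length_tail] <;> omega

end Runs

/-! ### Tape contents, and merging the formula with its colouring -/

section Passes

variable {s : ℕ}

/-! #### Clauses as triples of natural numbers -/

abbrev Clause := Fin 3 → ℕ

def codeClause (C : Clause) : List Bool :=
  MonotoneQBF.encodeNumeral (C 0) ++
    (MonotoneQBF.encodeNumeral (C 1) ++ MonotoneQBF.encodeNumeral (C 2))

def code (p q : ℕ) (cl : List Clause) : List Bool :=
  MonotoneQBF.encodeNumeral p ++ (MonotoneQBF.encodeNumeral q ++ cl.flatMap codeClause)

/-- Colours the clauses, from the last to the first, with the colours read off the certificate `c`;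
also returns the rest of the certificate. -/
def attach : List Clause → List Bool → List (Clause × Option Bool) × List Bool
  | [], c => ([], c)
  | C :: cl, c =>
    ((C, colourOf (attach cl c).2.head? (attach cl c).2.tail.head?) :: (attach cl c).1,
      (attach cl c).2.tail.tail)

def numColoured (cl : List (Clause × Option Bool)) : ℕ := cl.countP fun D => D.2.isSome

/-- The numeral of the variable `x` on the tape before pass `i`. -/
def numeralSyms (i : ℕ) (first : Bool) (c : Option Bool) (x : ℕ) : List Sym :=
  if i ≤ x then List.replicate (x - i) .one ++ [.term first c] else [.dead first c]

def clauseSyms (i : ℕ) (D : Clause × Option Bool) : List Sym :=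
  numeralSyms i true D.2 (D.1 0) ++
    (numeralSyms i false D.2 (D.1 1) ++ numeralSyms i false D.2 (D.1 2))

/-- The merging phase treats the header like the end of a clause, so it too receives a colour `h`.
-/
def header (p q : ℕ) (h : Option Bool) : List Sym :=
  List.replicate p .one ++ .term false h :: (List.replicate q .one ++ [.term false h])

def tape (i p q : ℕ) (h : Option Bool) (cl : List (Clause × Option Bool)) : List Sym :=
  header p q h ++ cl.flatMap (clauseSyms i)

theorem map_bitSym_encodeNumeral_reverse (k : ℕ) :
    ((MonotoneQBF.encodeNumeral k).map bitSym).reverse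
      = .term false none :: List.replicate k .one := by
  simp [MonotoneQBF.encodeNumeral, bitSym]

theorem length_encodeNumeral (k : ℕ) : (MonotoneQBF.encodeNumeral k).length = k + 1 := by
  simp [MonotoneQBF.encodeNumeral]

theorem merge_numeral (v : Reg s) (hs : v.sym = none) (hb : v.bit = none) (hp : v.pos ≠ 0) (k : ℕ)
    (i l r m) :
    Within s (k + 1)
      (cfg .merge v i (((MonotoneQBF.encodeNumeral k).map bitSym).reverse ++ l) r m)
      (cfg .merge { v with pos := v.pos + 1 } i l
        (List.replicate k .one ++ .term (v.pos = 2) v.colour :: r) m) := by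
  rw [map_bitSym_encodeNumeral_reverse, Nat.add_comm]
  exact (merge_term v hs hb hp _ _ _ _ _ _).trans
    (merge_ones { v with pos := v.pos + 1 } hs k _ _ _ _)

theorem merge_numeral_zero (v : Reg s) (hs : v.sym = none) (hb : v.bit = none) (hp : v.pos = 0)
    (k : ℕ) (c : List Bool) (l r m) :
    Within s (k + 1)
      (cfg .merge v (c.map some) (((MonotoneQBF.encodeNumeral k).map bitSym).reverse ++ l) r m)
      (cfg .merge { v with pos := 1, colour := colourOf c.head? c.tail.head? }
        (c.tail.tail.map some) l
        (List.replicate k .one ++ .term false (colourOf c.head? c.tail.head?) :: r)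
        (List.replicate (colourOf c.head? c.tail.head?).toList.length true ++ m)) := by
  rw [map_bitSym_encodeNumeral_reverse, Nat.add_comm]
  exact (merge_term_zero v hs hb hp _ _ _ _ _ _).trans
    (merge_ones { v with pos := 1, colour := colourOf c.head? c.tail.head? } hs k _ _ _ _)

theorem merge_clause (v : Reg s) (hs : v.sym = none) (hb : v.bit = none) (hp : v.pos = 0)
    (C : Clause) (c : List Bool) (l r m) :
    Within s (codeClause C).length
      (cfg .merge v (c.map some) (((codeClause C).map bitSym).reverse ++ l) r m)
      (cfg .merge { v with colour := colourOf c.head? c.tail.head? }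
        (c.tail.tail.map some) l (clauseSyms 0 (C, colourOf c.head? c.tail.head?) ++ r)
        (List.replicate (colourOf c.head? c.tail.head?).toList.length true ++ m)) := by
  have h1 := merge_numeral_zero v hs hb hp (C 2) c
    (((MonotoneQBF.encodeNumeral (C 1)).map bitSym).reverse ++
      (((MonotoneQBF.encodeNumeral (C 0)).map bitSym).reverse ++ l)) r m
  have h2 := h1.trans (merge_numeral
    { v with pos := 1, colour := colourOf c.head? c.tail.head? } hs hb (by simp) (C 1) _ _ _ _)
  have h3 := h2.trans (merge_numeral
    { v with pos := 2, colour := colourOf c.head? c.tail.head? } hs hb (by simp) (C 0) _ _ _ _)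
  have e : (2 : Fin 3) + 1 = v.pos := by rw [hp]; rfl
  simp only [e] at h3
  refine Eq.mp ?_ (h3.mono (n' := (codeClause C).length) ?_)
  · congr 1
    · simp [codeClause]
    · simp [clauseSyms, numeralSyms]
  · simp only [codeClause, List.length_append, length_encodeNumeral]
    omega

theorem merge_clauses (cl : List Clause) (v : Reg s) (hs : v.sym = none) (hb : v.bit = none)
    (hp : v.pos = 0) (c : List Bool) (l r m) :
    ∃ col, Within s (cl.flatMap codeClause).length
      (cfg .merge v (c.map some) (((cl.flatMap codeClause).map bitSym).reverse ++ l) r m)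
      (cfg .merge { v with colour := col } ((attach cl c).2.map some) l
        ((attach cl c).1.flatMap (clauseSyms 0) ++ r)
        (List.replicate (numColoured (attach cl c).1) true ++ m)) := by
  induction cl generalizing l with
  | nil => exact ⟨_, Within.refl _⟩
  | cons C cl ih =>
    obtain ⟨col, h1⟩ := ih (((codeClause C).map bitSym).reverse ++ l)
    have h2 := h1.trans (merge_clause { v with colour := col } hs hb hp C (attach cl c).2 l
      ((attach cl c).1.flatMap (clauseSyms 0) ++ r)
      (List.replicate (numColoured (attach cl c).1) true ++ m))
    refine ⟨colourOf (attach cl c).2.head? (attach cl c).2.tail.head?,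
      Eq.mp ?_ (h2.mono (n' := ((C :: cl).flatMap codeClause).length) ?_)⟩
    · congr 1
      · simp
      · simp only [attach, List.flatMap_cons, List.append_assoc, numColoured, List.countP_cons]
        rw [← List.append_assoc (List.replicate _ true), ← List.replicate_add]
        congr 3
        cases colourOf (attach cl c).2.head? (attach cl c).2.tail.head? <;> simp [Nat.add_comm]
    · simp [Nat.add_comm]

/-- Colour given to the header of the tape, after the clauses have been coloured. -/
def headerColour (cl : List Clause) (c : List Bool) : Option Bool :=
  colourOf (attach cl c).2.head? (attach cl c).2.tail.head?

theorem within_merge (p q : ℕ) (cl : List Clause) (v : Reg s) (hs : v.sym = none)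
    (hb : v.bit = none) (hp : v.pos = 0) (hc : v.colour = none) (hv : v.verdict = false)
    (c : List Bool) :
    Within s ((code p q cl).length + 1)
      (cfg .merge v (c.map some) (((code p q cl).map bitSym).reverse) [] [])
      (cfg .scan { v with pos := 2 } ((attach cl c).2.tail.tail.map some) []
        (tape 0 p q (headerColour cl c) (attach cl c).1)
        (List.replicate ((headerColour cl c).toList.length + numColoured (attach cl c).1)
          true)) := by
  obtain ⟨col, h1⟩ := merge_clauses cl v hs hb hp c
    (((MonotoneQBF.encodeNumeral q).map bitSym).reverse ++
      (((MonotoneQBF.encodeNumeral p).map bitSym).reverse ++ [])) [] []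
  have h2 := h1.trans (merge_numeral_zero { v with colour := col } hs hb hp q _ _ _ _)
  have h3 := h2.trans (merge_numeral
    { v with pos := 1, colour := headerColour cl c } hs hb (by simp) p _ _ _ _)
  have h4 := h3.trans (merge_end { v with pos := 2, colour := headerColour cl c } _ _ _)
  refine Eq.mp ?_ (h4.mono (n' := (code p q cl).length + 1) ?_)
  · congr 1
    · simp [code]
    · simp [tape, header, headerColour, ← hs, ← hv, ← hc]
  · simp only [code, List.length_append, length_encodeNumeral]
    omega

end Passes

/-! ### A single pass over the tape -/

section Scans

variable {s : ℕ}

/-- The part of the machine's memory that a pass changes: the tally, the underflow flag, and the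
stack of marks. -/
abbrev PassState (s : ℕ) := Tally s × Bool × List Bool

/-- The effect on the memory of a numeral `x` in a clause of colour `c` during pass `i`. -/
def numeralAct (mode : Mode) (i : ℕ) (first : Bool) (c : Option Bool) (x : ℕ) (S : PassState s) :
    PassState s :=
  (S.1.event first c (decide (x = i)) (decide (i ≤ x)),
    if x = i ∧ mode = .univ ∧ c.isSome then (S.2.1 || S.2.2.isEmpty, S.2.2.tail) else S.2)

def clauseAct (mode : Mode) (i : ℕ) (S : PassState s) (D : Clause × Option Bool) : PassState s :=
  numeralAct mode i false D.2 (D.1 2)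
    (numeralAct mode i false D.2 (D.1 1) (numeralAct mode i true D.2 (D.1 0) S))

/-- The registers of `v`, with tally and underflow flag from `S`. -/
def Reg.withState (v : Reg s) (S : PassState s) : Reg s :=
  { v with tally := S.1, under := S.2.1 }

theorem scan_copy_ones (v : Reg s) (hs : v.sym = none)
    (hh : v.head = .inUniv ∨ v.head = .inExist ∨ v.head = .inToken) (k : ℕ) (i l r m) :
    Within s k (cfg .scan v i l (List.replicate k .one ++ r) m)
      (cfg .scan v i (List.replicate k .one ++ l) r m) := by
  induction k generalizing l with
  | zero => exact Within.refl _
  | succ k ih =>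
    have h1 : Within s 1 (cfg .scan v i l (List.replicate (k + 1) .one ++ r) m)
        (cfg .scan v i (.one :: l) (List.replicate k .one ++ r) m) := by
      apply Within.of_step
      rcases hh with hh | hh | hh <;>
        simp [prog, scanStmt, scanEmit, scanFinish, popsMark, emits, emitSym, scanUpdate, hh, ← hs,
          List.replicate_succ] <;>
        rw [← hh]
    have h2 := (h1.trans (ih _)).mono (Nat.add_comm 1 k).le
    have e : List.replicate (k + 1) Sym.one ++ l = List.replicate k .one ++ .one :: l := by
      simp [List.replicate_succ']
    rwa [e]

/-- A numeral `x < i` is dead and is copied, `x = i` has no digits left and dies now, `x > i` loses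
one digit. In each case the result is its form for pass `i + 1`. -/
theorem scan_numeral (v : Reg s) (hs : v.sym = none) (hh : v.head = .token) (i : ℕ) (f c)
    (x : ℕ) (j l r m) :
    Within s (numeralSyms i f c x).length (cfg .scan v j l (numeralSyms i f c x ++ r) m)
      (cfg .scan (v.withState (numeralAct v.mode i f c x (v.tally, v.under, m))) j
        ((numeralSyms (i + 1) f c x).reverse ++ l) r
        (numeralAct v.mode i f c x (v.tally, v.under, m)).2.2) := by
  rcases lt_trichotomy x i with hx | rfl | hx
  · have h1 : ¬ i ≤ x := by omega
    have h2 : ¬ i + 1 ≤ x := by omega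
    have h3 : x ≠ i := by omega
    apply Within.mono (Within.of_step _) (n := 1)
    · simp [numeralSyms, h1]
    simp [numeralSyms, numeralAct, Reg.withState, h1, h2, h3, prog, scanStmt, scanEmit, scanFinish,
      popsMark, emits, emitSym, scanUpdate, hh, ← hs]
  · have h2 : ¬ x + 1 ≤ x := by omega
    apply Within.mono (Within.of_step _) (n := 1)
    · simp [numeralSyms]
    cases hm : v.mode <;> rcases c with _ | c <;> rcases m with _ | ⟨b, m⟩ <;>
      simp [numeralSyms, numeralAct, Reg.withState, h2, prog, scanStmt, scanEmit, scanFinish,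
        popsMark, emits, emitSym, scanUpdate, hh, hm, ← hs]
  · obtain ⟨k, rfl⟩ := Nat.exists_eq_add_of_lt hx
    have h1 : i ≤ i + k + 1 := by omega
    have h2 : i + 1 ≤ i + k + 1 := by omega
    have h3 : i + k + 1 ≠ i := by omega
    have e1 : i + k + 1 - i = k + 1 := by omega
    have e2 : i + k + 1 - (i + 1) = k := by omega
    simp only [numeralSyms, h1, h2, if_true, e1, e2]
    have s1 : Within s 1 (cfg .scan v j l (.one :: (List.replicate k .one ++ .term f c :: r)) m)
        (cfg .scan { v with head := .inToken } j l (List.replicate k .one ++ .term f c :: r) m) := by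
      apply Within.of_step
      simp [prog, scanStmt, scanEmit, scanFinish, popsMark, emits, scanUpdate, hh, ← hs]
    have s2 := s1.trans (scan_copy_ones { v with head := .inToken } hs (by simp) k j l
      (.term f c :: r) m)
    have s3 : Within s 1
        (cfg .scan { v with head := .inToken } j (List.replicate k .one ++ l) (.term f c :: r) m)
        (cfg .scan (v.withState (numeralAct v.mode i f c (i + k + 1) (v.tally, v.under, m))) j
          (.term f c :: (List.replicate k .one ++ l)) r m) := by
      apply Within.of_step
      simp [numeralAct, Reg.withState, h1, h3, prog, scanStmt, scanEmit, scanFinish,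
        popsMark, emits, emitSym, scanUpdate, ← hh, ← hs]
    have s4 := s2.trans s3
    refine Eq.mp ?_ (s4.mono (n' := (List.replicate (k + 1) Sym.one ++ [Sym.term f c]).length) ?_)
    · congr 1
      · simp [List.replicate_succ]
      · simp [numeralAct, h3]
    · simp
      omega

@[simp] theorem Reg.withState_tally (v : Reg s) (S : PassState s) :
    (v.withState S).tally = S.1 := rfl
@[simp] theorem Reg.withState_under (v : Reg s) (S : PassState s) :
    (v.withState S).under = S.2.1 := rfl
@[simp] theorem Reg.withState_mode (v : Reg s) (S : PassState s) :
    (v.withState S).mode = v.mode := rfl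
@[simp] theorem Reg.withState_withState (v : Reg s) (S S' : PassState s) :
    (v.withState S).withState S' = v.withState S' := rfl

theorem scan_clause (v : Reg s) (hs : v.sym = none) (hh : v.head = .token) (i : ℕ)
    (D : Clause × Option Bool) (j l r) (S : PassState s) :
    Within s (clauseSyms i D).length (cfg .scan (v.withState S) j l (clauseSyms i D ++ r) S.2.2)
      (cfg .scan (v.withState (clauseAct v.mode i S D)) j
        ((clauseSyms (i + 1) D).reverse ++ l) r (clauseAct v.mode i S D).2.2) := by
  have h (f x l r) (S : PassState s) := scan_numeral (v.withState S) hs hh i f D.2 x j l r S.2.2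
  simp only [Reg.withState_withState, Reg.withState_tally, Reg.withState_under,
    Reg.withState_mode] at h
  have h1 := (h true (D.1 0) l (numeralSyms i false D.2 (D.1 1) ++
    (numeralSyms i false D.2 (D.1 2) ++ r)) S).trans (h false (D.1 1) _ _ _)
  have h2 := h1.trans (h false (D.1 2) _ _ _)
  refine Eq.mp ?_ (h2.mono (n' := (clauseSyms i D).length) ?_)
  · simp [clauseSyms, clauseAct]
  · simp only [clauseSyms, List.length_append]
    omega

theorem scan_clauses (cl : List (Clause × Option Bool)) (v : Reg s) (hs : v.sym = none)
    (hh : v.head = .token) (i : ℕ) (j l r) (S : PassState s) :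
    Within s (cl.flatMap (clauseSyms i)).length
      (cfg .scan (v.withState S) j l (cl.flatMap (clauseSyms i) ++ r) S.2.2)
      (cfg .scan (v.withState (cl.foldl (clauseAct v.mode i) S)) j
        ((cl.flatMap (clauseSyms (i + 1))).reverse ++ l) r
        (cl.foldl (clauseAct v.mode i) S).2.2) := by
  induction cl generalizing l S with
  | nil => exact Within.refl _
  | cons D cl ih =>
    have h := (scan_clause v hs hh i D j l (cl.flatMap (clauseSyms i) ++ r) S).trans (ih _ _)
    simpa using h

theorem scan_header_rest (v : Reg s) (hs : v.sym = none) (hh : v.head = .inExist) (q h j l r m) :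
    Within s (q + 1) (cfg .scan v j l (List.replicate q .one ++ .term false h :: r) m)
      (cfg .scan { v with head := .token } j (.term false h :: (List.replicate q .one ++ l)) r m) := by
  refine (scan_copy_ones v hs (by simp [hh]) q j l _ m).trans (Within.of_step ?_)
  simp [prog, scanStmt, scanEmit, scanFinish, popsMark, emits, emitSym, scanUpdate, hh, ← hs]

theorem scan_header_univ (v : Reg s) (hs : v.sym = none) (hh : v.head = .start) (p q h j l r m) :
    Within s (header (p + 1) q h).length (cfg .scan v j l (header (p + 1) q h ++ r) m)
      (cfg .scan { v with head := .token, mode := .univ } j ((header p q h).reverse ++ l) r m) := by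
  have s1 : Within s 1 (cfg .scan v j l (header (p + 1) q h ++ r) m)
      (cfg .scan { v with head := .inUniv, mode := .univ } j l (header p q h ++ r) m) := by
    apply Within.of_step
    simp [header, List.replicate_succ, prog, scanStmt, scanEmit, scanFinish, popsMark, emits,
      scanUpdate, hh, ← hs]
  have e : header p q h ++ r
      = List.replicate p .one ++ .term false h :: (List.replicate q .one ++ .term false h :: r) := by
    simp [header]
  rw [e] at s1
  have s2 := s1.trans (scan_copy_ones { v with head := .inUniv, mode := .univ } hs (by simp) p j l
    _ m)
  have s3 : Within s 1 (cfg .scan { v with head := .inUniv, mode := .univ } j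
        (List.replicate p .one ++ l)
        (.term false h :: (List.replicate q .one ++ .term false h :: r)) m)
      (cfg .scan { v with head := .inExist, mode := .univ } j
        (.term false h :: (List.replicate p .one ++ l))
        (List.replicate q .one ++ .term false h :: r) m) := by
    apply Within.of_step
    simp [prog, scanStmt, scanEmit, scanFinish, popsMark, emits, emitSym, scanUpdate, ← hs]
  have s4 := (s2.trans s3).trans (scan_header_rest { v with head := .inExist, mode := .univ } hs rfl
    q h j _ r m)
  refine Eq.mp ?_ (s4.mono (n' := (header (p + 1) q h).length) ?_)
  · congr 1
    simp [header]
  · simp [header]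
    omega

theorem scan_header_exist (v : Reg s) (hs : v.sym = none) (hh : v.head = .start) (q h j l r m) :
    Within s (header 0 (q + 1) h).length (cfg .scan v j l (header 0 (q + 1) h ++ r) m)
      (cfg .scan { v with head := .token, mode := .exist } j ((header 0 q h).reverse ++ l) r m) := by
  have s1 : Within s 1 (cfg .scan v j l (header 0 (q + 1) h ++ r) m)
      (cfg .scan { v with head := .startExist, mode := .final } j (.term false h :: l)
        (.one :: (List.replicate q .one ++ .term false h :: r)) m) := by
    apply Within.of_step
    simp [header, List.replicate_succ, prog, scanStmt, scanEmit, scanFinish, popsMark, emits,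
      emitSym, scanUpdate, hh, ← hs]
  have s2 : Within s 1 (cfg .scan { v with head := .startExist, mode := .final } j
        (.term false h :: l) (.one :: (List.replicate q .one ++ .term false h :: r)) m)
      (cfg .scan { v with head := .inExist, mode := .exist } j (.term false h :: l)
        (List.replicate q .one ++ .term false h :: r) m) := by
    apply Within.of_step
    simp [prog, scanStmt, scanEmit, scanFinish, popsMark, emits, scanUpdate, ← hs]
  have s4 := (s1.trans s2).trans (scan_header_rest { v with head := .inExist, mode := .exist } hs rfl
    q h j _ r m)
  refine Eq.mp ?_ (s4.mono (n' := (header 0 (q + 1) h).length) ?_)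
  · congr 1
    simp [header]
  · simp [header]
    omega

theorem scan_header_final (v : Reg s) (hs : v.sym = none) (hh : v.head = .start) (h j l r m) :
    Within s (header 0 0 h).length (cfg .scan v j l (header 0 0 h ++ r) m)
      (cfg .scan { v with head := .token, mode := .final } j ((header 0 0 h).reverse ++ l) r m) := by
  have s1 : Within s 1 (cfg .scan v j l (header 0 0 h ++ r) m)
      (cfg .scan { v with head := .startExist, mode := .final } j (.term false h :: l)
        (.term false h :: r) m) := by
    apply Within.of_step
    simp [header, prog, scanStmt, scanEmit, scanFinish, popsMark, emits,
      emitSym, scanUpdate, hh, ← hs]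
  refine s1.trans (Within.of_step ?_)
  simp [header, prog, scanStmt, scanEmit, scanFinish, popsMark, emits, emitSym, scanUpdate, ← hs]

theorem scan_end (v : Reg s) (j l m) :
    Within s 1 (cfg .scan v j l [] m)
      (cfg (if v.mode = .final then .clear else .rewind) (endPass v) j l [] m) := by
  apply Within.of_step
  cases hm : v.mode <;> simp [prog, scanStmt, endPass, hm]

/-- The memory after the clauses have been read in pass `i`. -/
def passState (mode : Mode) (i : ℕ) (cl : List (Clause × Option Bool)) (u : Bool) (m : List Bool) :
    PassState s :=
  cl.foldl (clauseAct mode i) ({}, u, m)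

/-- The registers after pass `i`. -/
def passReg (mode : Mode) (i : ℕ) (cl : List (Clause × Option Bool)) (v : Reg s) (m : List Bool) :
    Reg s :=
  endPass ({ v with head := .token, mode := mode }.withState (passState mode i cl v.under m))

/-- The three kinds of pass differ only in how they cross the header; that run is the hypothesis
`hH`. -/
theorem scan_pass (mode : Mode) (v : Reg s) (hs : v.sym = none) (ht : v.tally = {})
    (i : ℕ) (cl : List (Clause × Option Bool)) (H H' : List Sym) (j m)
    (hH : ∀ r, Within s H.length (cfg .scan v j [] (H ++ r) m)
      (cfg .scan { v with head := .token, mode := mode } j (H'.reverse ++ []) r m)) :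
    Within s ((H ++ cl.flatMap (clauseSyms i)).length + 1)
      (cfg .scan v j [] (H ++ cl.flatMap (clauseSyms i)) m)
      (cfg (if mode = .final then .clear else .rewind) (passReg mode i cl v m) j
        (H' ++ cl.flatMap (clauseSyms (i + 1))).reverse []
        (passState (s := s) mode i cl v.under m).2.2) := by
  have h2 := scan_clauses cl { v with head := .token, mode := mode } hs rfl i j (H'.reverse ++ []) []
    ({}, v.under, m)
  have e : { v with head := Head.token, mode := mode }.withState ({}, v.under, m)
      = { v with head := .token, mode := mode } := by
    simp [Reg.withState, ← ht]
  rw [e] at h2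
  have h3 := ((hH _).trans h2).trans (scan_end _ _ _ _)
  refine Eq.mp ?_ (h3.mono (n' := (H ++ cl.flatMap (clauseSyms i)).length + 1) ?_)
  · simp [passReg, passState]
    rfl
  · simp

end Scans

/-! ### What the tally and the marks record in a pass -/

section Counting

variable {s : ℕ}

/-- The number of appearances of `i` in the clause `C`. -/
def hits (i : ℕ) (C : Clause) : ℕ := (Finset.univ.filter fun k => C k = i).card

/-- The number of appearances of `i`. -/
def occ (i : ℕ) (cl : List Clause) : ℕ := (cl.map (hits i)).sum

/-- The number of appearances of `i` in coloured clauses. -/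
def colouredOcc (i : ℕ) (cl : List (Clause × Option Bool)) : ℕ :=
  (cl.map fun D => if D.2.isSome then hits i D.1 else 0).sum

theorem hits_eq (i : ℕ) (C : Clause) :
    hits i C = (if C 0 = i then 1 else 0) + (if C 1 = i then 1 else 0) +
      (if C 2 = i then 1 else 0) := by
  rw [hits, Finset.card_filter, Fin.sum_univ_three]

/-- The effect of removing `n` marks. -/
def takeMarks (n : ℕ) (S : Bool × List Bool) : Bool × List Bool :=
  (S.1 || decide (S.2.length < n), S.2.drop n)

theorem takeMarks_zero (S : Bool × List Bool) : takeMarks 0 S = S := by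
  simp [takeMarks]

theorem takeMarks_one (S : Bool × List Bool) : takeMarks 1 S = (S.1 || S.2.isEmpty, S.2.tail) := by
  rcases S with ⟨u, _ | ⟨a, m⟩⟩ <;> simp [takeMarks]

/-- Underflow depends only on the total number of removals, so all passes together act like one. -/
theorem takeMarks_add (a b : ℕ) (S : Bool × List Bool) :
    takeMarks (a + b) S = takeMarks b (takeMarks a S) := by
  simp only [takeMarks, List.length_drop, List.drop_drop, Bool.or_assoc, Prod.mk.injEq, and_true]
  congr 1
  rw [← Bool.decide_or]
  congr 1
  simp only [eq_iff_iff]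
  omega

theorem numeralAct_marks (mode : Mode) (i : ℕ) (f c x) (S : PassState s) :
    (numeralAct mode i f c x S).2
      = takeMarks (if mode = .univ ∧ c.isSome then (if x = i then 1 else 0) else 0) S.2 := by
  by_cases h1 : mode = .univ <;> by_cases h2 : c.isSome <;> by_cases h3 : x = i <;>
    simp [numeralAct, h1, h2, h3, takeMarks_zero, takeMarks_one]

theorem passState_marks (mode : Mode) (i : ℕ) (cl : List (Clause × Option Bool)) (u m) :
    (passState (s := s) mode i cl u m).2
      = takeMarks (if mode = .univ then colouredOcc i cl else 0) (u, m) := by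
  have key : ∀ S : PassState s, (cl.foldl (clauseAct mode i) S).2
      = takeMarks (if mode = .univ then colouredOcc i cl else 0) S.2 := by
    induction cl with
    | nil => intro S; simp [colouredOcc, takeMarks_zero]
    | cons D cl ih =>
      intro S
      rw [List.foldl_cons, ih, clauseAct, numeralAct_marks, numeralAct_marks, numeralAct_marks,
        ← takeMarks_add, ← takeMarks_add, ← takeMarks_add]
      congr 1
      by_cases h1 : mode = .univ <;> by_cases h2 : D.2.isSome <;>
        simp [h1, h2, colouredOcc, hits_eq, Nat.add_assoc]
  exact key _

theorem satSucc_val (t : Fin (s + 3)) : (Tally.satSucc t).val = min (t.val + 1) (s + 2) := rfl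

theorem clauseAct_total (mode : Mode) (i : ℕ) (S : PassState s) (D : Clause × Option Bool) :
    (clauseAct mode i S D).1.total.val = min (S.1.total.val + hits i D.1) (s + 2) := by
  have := S.1.total.isLt
  simp only [clauseAct, numeralAct, Tally.event, hits_eq, decide_eq_true_eq]
  split_ifs <;> (try simp only [satSucc_val]) <;> omega

theorem clauseAct_seen (mode : Mode) (i : ℕ) (S : PassState s) (D : Clause × Option Bool) (c) :
    (clauseAct mode i S D).1.seen c = true ↔
      S.1.seen c = true ∨ D.2 = c ∧ ∃ k, D.1 k = i := by
  simp only [clauseAct, numeralAct, Tally.event, Fin.exists_fin_succ, decide_eq_true_eq]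
  by_cases hc : D.2 = c
  · subst hc
    by_cases h0 : D.1 0 = i <;> by_cases h1 : D.1 1 = i <;> by_cases h2 : D.1 2 = i <;>
      simp [h0, h1, h2]
  · have hc' : c ≠ D.2 := Ne.symm hc
    split_ifs <;> simp [hc, hc', Function.update_of_ne]

/-- The first numeral of a clause resets `inClause`, so nothing carries over from the previous
clause. -/
theorem clauseAct_dup (mode : Mode) (i : ℕ) (S : PassState s) (D : Clause × Option Bool) :
    (clauseAct mode i S D).1.dup = true ↔ S.1.dup = true ∨ 2 ≤ hits i D.1 := by
  simp only [clauseAct, numeralAct, Tally.event, hits_eq]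
  by_cases h0 : D.1 0 = i <;> by_cases h1 : D.1 1 = i <;> by_cases h2 : D.1 2 = i <;>
    simp [h0, h1, h2]

theorem clauseAct_alive (mode : Mode) (i : ℕ) (S : PassState s) (D : Clause × Option Bool) :
    (clauseAct mode i S D).1.alive = true ↔ S.1.alive = true ∨ ∃ k, i ≤ D.1 k := by
  simp [clauseAct, numeralAct, Tally.event, Fin.exists_fin_succ, or_assoc]

theorem passState_total (mode : Mode) (i : ℕ) (cl : List (Clause × Option Bool)) (u m) :
    (passState (s := s) mode i cl u m).1.total.val = min (occ i (cl.map Prod.fst)) (s + 2) := by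
  have key : ∀ S : PassState s, (cl.foldl (clauseAct mode i) S).1.total.val
      = min (S.1.total.val + occ i (cl.map Prod.fst)) (s + 2) := by
    induction cl with
    | nil =>
      intro S
      have := S.1.total.isLt
      simp [occ]
      omega
    | cons D cl ih =>
      intro S
      rw [List.foldl_cons, ih, clauseAct_total]
      simp only [occ, List.map_cons, List.sum_cons]
      omega
  rw [passState, key]
  simp

/-- Flags that are raised clause by clause. -/
theorem foldl_flag {α β : Type*} (f : α → β → α) (P : α → Prop) (Q : β → Prop)
    (h : ∀ a b, P (f a b) ↔ P a ∨ Q b) (l : List β) (a : α) :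
    P (l.foldl f a) ↔ P a ∨ ∃ b ∈ l, Q b := by
  induction l generalizing a with
  | nil => simp
  | cons b l ih => simp [ih, h, or_assoc]

theorem passState_seen (mode : Mode) (i : ℕ) (cl : List (Clause × Option Bool)) (u m c) :
    (passState (s := s) mode i cl u m).1.seen c = true ↔
      ∃ D ∈ cl, D.2 = c ∧ ∃ k, D.1 k = i := by
  have := foldl_flag (clauseAct (s := s) mode i) (fun S => S.1.seen c = true) _
    (fun S D => clauseAct_seen mode i S D c) cl ({}, u, m)
  rw [passState, this]
  simp

theorem passState_dup (mode : Mode) (i : ℕ) (cl : List (Clause × Option Bool)) (u m) :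
    (passState (s := s) mode i cl u m).1.dup = true ↔ ∃ D ∈ cl, 2 ≤ hits i D.1 := by
  have := foldl_flag (clauseAct (s := s) mode i) (fun S => S.1.dup = true) _
    (fun S D => clauseAct_dup mode i S D) cl ({}, u, m)
  rw [passState, this]
  simp

theorem passState_alive (mode : Mode) (i : ℕ) (cl : List (Clause × Option Bool)) (u m) :
    (passState (s := s) mode i cl u m).1.alive = true ↔ ∃ D ∈ cl, ∃ k, i ≤ D.1 k := by
  have := foldl_flag (clauseAct (s := s) mode i) (fun S => S.1.alive = true) _
    (fun S D => clauseAct_alive mode i S D) cl ({}, u, m)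
  rw [passState, this]
  simp

end Counting

/-! ### The invariant of the passes and the final verdict -/

section Loop

variable {s : ℕ}

theorem length_numeralSyms_succ_le (i : ℕ) (f c x) :
    (numeralSyms (i + 1) f c x).length ≤ (numeralSyms i f c x).length := by
  unfold numeralSyms
  split_ifs <;> simp <;> omega

theorem length_flatMap_clauseSyms_succ_le (i : ℕ) (cl : List (Clause × Option Bool)) :
    (cl.flatMap (clauseSyms (i + 1))).length ≤ (cl.flatMap (clauseSyms i)).length := by
  induction cl with
  | nil => simp
  | cons D cl ih =>
    have h := fun f => length_numeralSyms_succ_le i f D.2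
    have h0 := h true (D.1 0)
    have h1 := h false (D.1 1)
    have h2 := h false (D.1 2)
    simp only [List.flatMap_cons, clauseSyms, List.length_append] at ih ⊢
    omega

theorem length_header (p q : ℕ) (h) : (header p q h).length = p + q + 2 := by
  simp [header]
  omega

/-- The tape before pass `i`. -/
def tapeAt (i p q : ℕ) (h : Option Bool) (cl : List (Clause × Option Bool)) : List Sym :=
  -- Truncated subtraction: the universal counter runs down during the first `p` passes, the
  -- existential one afterwards.
  tape i (p - i) (q - (i - p)) h cl

theorem length_tapeAt_succ_le (i p q h cl) :
    (tapeAt (i + 1) p q h cl).length ≤ (tapeAt i p q h cl).length := by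
  have := length_flatMap_clauseSyms_succ_le i cl
  simp only [tapeAt, tape, List.length_append, length_header]
  omega

theorem length_tapeAt_le (i p q h cl) :
    (tapeAt i p q h cl).length ≤ (tape 0 p q h cl).length := by
  induction i with
  | zero => simp [tapeAt]
  | succ i ih => exact (length_tapeAt_succ_le i p q h cl).trans ih

/-- Both colours appear among the clauses containing the universal variable `i`, or the colours
of the clauses containing the existential variable `i` are not as required. -/
def BadAt (p : ℕ) (cl : List (Clause × Option Bool)) (i : ℕ) : Prop :=
  let seen := fun c => ∃ D ∈ cl, D.2 = c ∧ ∃ k, D.1 k = i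
  if i < p then seen (some true) ∧ seen (some false)
  else ¬ ((¬ seen (some true) ∧ ¬ seen (some false)) ∨
    (¬ seen none ∧ seen (some true) ∧ seen (some false)))

/-- The number of appearances of the variable `i` is wrong, or `i` is repeated in a clause. -/
def InvalidAt (s p : ℕ) (cl : List Clause) (i : ℕ) : Prop :=
  occ i cl ≠ (if i < p then s else 2) ∨ ∃ C ∈ cl, 2 ≤ hits i C

/-- The registers and marks after `i` passes. -/
structure LoopInv (s p : ℕ) (cl : List (Clause × Option Bool)) (m₀ : List Bool) (i : ℕ)
    (v : Reg s) (m : List Bool) : Prop where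
  sym : v.sym = none
  head : v.head = .start
  tally : v.tally = {}
  invalid : v.invalid = true ↔ ∃ i' < i, InvalidAt s p (cl.map Prod.fst) i'
  bad : v.bad = true ↔ ∃ i' < i, BadAt p cl i'
  -- Only universal passes remove marks, hence `min i p`.
  marks : (v.under, m) = takeMarks (∑ i' ∈ Finset.range (min i p), colouredOcc i' cl) (false, m₀)

theorem exists_lt_succ_iff (P : ℕ → Prop) (i : ℕ) :
    (∃ i' < i + 1, P i') ↔ (∃ i' < i, P i') ∨ P i := by
  constructor
  · rintro ⟨j, hj, h⟩
    rcases Nat.lt_succ_iff_lt_or_eq.1 hj with hj | rfl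
    · exact Or.inl ⟨j, hj, h⟩
    · exact Or.inr h
  · rintro (⟨j, hj, h⟩ | h)
    · exact ⟨j, by omega, h⟩
    · exact ⟨i, by omega, h⟩

theorem exists_dup_iff (i : ℕ) (cl : List (Clause × Option Bool)) :
    (∃ C ∈ cl.map Prod.fst, 2 ≤ hits i C) ↔ ∃ D ∈ cl, 2 ≤ hits i D.1 := by
  simp

theorem LoopInv.succ_univ {p : ℕ} {cl : List (Clause × Option Bool)} {m₀ : List Bool}
    {i : ℕ} {v : Reg s} {m : List Bool} (h : LoopInv s p cl m₀ i v m) (hi : i < p) :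
    LoopInv s p cl m₀ (i + 1) (passReg .univ i cl v m)
      (passState (s := s) .univ i cl v.under m).2.2 where
  sym := rfl
  head := rfl
  tally := rfl
  invalid := by
    rw [exists_lt_succ_iff, ← h.invalid, InvalidAt, exists_dup_iff,
      ← passState_dup (s := s) .univ i cl v.under m]
    simp only [passReg, endPass, Reg.withState, passState_total, hi, if_true, Bool.or_eq_true,
      decide_eq_true_eq, or_assoc]
    have : min (occ i (cl.map Prod.fst)) (s + 2) ≠ s ↔ occ i (cl.map Prod.fst) ≠ s := by omega
    rw [this]
  bad := by
    rw [exists_lt_succ_iff, ← h.bad]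
    simp only [BadAt, ← passState_seen (s := s) .univ i cl v.under m, hi, if_true]
    simp [passReg, endPass, Reg.withState]
  marks := by
    have h1 := passState_marks (s := s) .univ i cl v.under m
    rw [if_pos rfl, h.marks, ← takeMarks_add] at h1
    have e : min (i + 1) p = min i p + 1 := by omega
    have e' : min i p = i := by omega
    rw [e, Finset.sum_range_succ]
    rw [e'] at h1 ⊢
    rw [← h1]
    rfl

theorem LoopInv.succ_exist {p : ℕ} {cl : List (Clause × Option Bool)} {m₀ : List Bool}
    {i : ℕ} {v : Reg s} {m : List Bool} (hs : 0 < s) (h : LoopInv s p cl m₀ i v m) (hi : ¬ i < p) :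
    LoopInv s p cl m₀ (i + 1) (passReg .exist i cl v m)
      (passState (s := s) .exist i cl v.under m).2.2 where
  sym := rfl
  head := rfl
  tally := rfl
  invalid := by
    rw [exists_lt_succ_iff, ← h.invalid, InvalidAt, exists_dup_iff,
      ← passState_dup (s := s) .exist i cl v.under m]
    simp only [passReg, endPass, Reg.withState, passState_total, hi, if_false, Bool.or_eq_true,
      decide_eq_true_eq, or_assoc]
    -- Positivity of `s` is needed here: the ceiling `s + 2` must differ from 2.
    have : min (occ i (cl.map Prod.fst)) (s + 2) ≠ 2 ↔ occ i (cl.map Prod.fst) ≠ 2 := by omega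
    rw [this]
  bad := by
    rw [exists_lt_succ_iff, ← h.bad]
    simp only [BadAt, ← passState_seen (s := s) .exist i cl v.under m, hi, if_false]
    simp only [passReg, endPass, Reg.withState, Tally.existOK]
    generalize (passState (s := s) .exist i cl v.under m).1.seen = f
    cases f none <;> cases f (some true) <;> cases f (some false) <;> simp
  marks := by
    have h1 := passState_marks (s := s) .exist i cl v.under m
    rw [if_neg (by simp), takeMarks_zero] at h1
    have e : min (i + 1) p = min i p := by omega
    rw [e, ← h.marks, ← h1]
    rfl

/-- The factor 2 accounts for scanning and rewinding a tape that never grows. -/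
theorem within_pass {p q : ℕ} {cl : List (Clause × Option Bool)} {m₀ : List Bool} {i : ℕ}
    {v : Reg s} {m : List Bool} (hs : 0 < s) (h : LoopInv s p cl m₀ i v m) (hi : i < p + q) (hc j) :
    ∃ v' m', LoopInv s p cl m₀ (i + 1) v' m' ∧
      Within s (2 * (tape 0 p q hc cl).length + 2) (cfg .scan v j [] (tapeAt i p q hc cl) m)
        (cfg .scan v' j [] (tapeAt (i + 1) p q hc cl) m') := by
  have len := length_tapeAt_le i p q hc cl
  have len' := length_tapeAt_le (i + 1) p q hc cl
  by_cases hp : i < p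
  · refine ⟨_, _, h.succ_univ hp, ?_⟩
    obtain ⟨p', hp'⟩ : ∃ p', p - i = p' + 1 := ⟨p - i - 1, by omega⟩
    have e1 : tapeAt i p q hc cl = header (p' + 1) q hc ++ cl.flatMap (clauseSyms i) := by
      rw [tapeAt, tape, hp', show i - p = 0 by omega, Nat.sub_zero]
    have e2 : tapeAt (i + 1) p q hc cl = header p' q hc ++ cl.flatMap (clauseSyms (i + 1)) := by
      rw [tapeAt, tape, show p - (i + 1) = p' by omega, show i + 1 - p = 0 by omega, Nat.sub_zero]
    have h1 := scan_pass .univ v h.sym h.tally i cl (header (p' + 1) q hc) (header p' q hc) j m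
      (fun r => scan_header_univ v h.sym h.head p' q hc j [] r m)
    rw [← e1, ← e2, if_neg (by simp)] at h1
    have h2 := h1.trans (within_rewind _ (passReg .univ i cl v m) rfl _ _ _)
    rw [List.reverse_reverse, List.append_nil, List.length_reverse] at h2
    exact h2.mono (by omega)
  · refine ⟨_, _, h.succ_exist hs hp, ?_⟩
    obtain ⟨q', hq'⟩ : ∃ q', q - (i - p) = q' + 1 := ⟨q - (i - p) - 1, by omega⟩
    have e1 : tapeAt i p q hc cl = header 0 (q' + 1) hc ++ cl.flatMap (clauseSyms i) := by
      rw [tapeAt, tape, hq', show p - i = 0 by omega]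
    have e2 : tapeAt (i + 1) p q hc cl = header 0 q' hc ++ cl.flatMap (clauseSyms (i + 1)) := by
      rw [tapeAt, tape, show p - (i + 1) = 0 by omega, show q - (i + 1 - p) = q' by omega]
    have h1 := scan_pass .exist v h.sym h.tally i cl (header 0 (q' + 1) hc) (header 0 q' hc) j m
      (fun r => scan_header_exist v h.sym h.head q' hc j [] r m)
    rw [← e1, ← e2, if_neg (by simp)] at h1
    have h2 := h1.trans (within_rewind _ (passReg .exist i cl v m) rfl _ _ _)
    rw [List.reverse_reverse, List.append_nil, List.length_reverse] at h2
    exact h2.mono (by omega)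

theorem within_passes {p q : ℕ} {cl : List (Clause × Option Bool)} {m₀ : List Bool}
    {v : Reg s} (hs : 0 < s) (h : LoopInv s p cl m₀ 0 v m₀) (hc j) (i : ℕ) (hi : i ≤ p + q) :
    ∃ v' m', LoopInv s p cl m₀ i v' m' ∧
      Within s (i * (2 * (tape 0 p q hc cl).length + 2)) (cfg .scan v j [] (tape 0 p q hc cl) m₀)
        (cfg .scan v' j [] (tapeAt i p q hc cl) m') := by
  induction i with
  | zero =>
    refine ⟨v, m₀, h, ?_⟩
    simpa [tapeAt] using Within.refl _
  | succ i ih =>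
    obtain ⟨v', m', h', w⟩ := ih (by omega)
    obtain ⟨v'', m'', h'', w'⟩ := within_pass (q := q) hs h' (by omega) hc j
    exact ⟨v'', m'', h'', (w.trans w').mono (Nat.succ_mul _ _).ge⟩

/-- What the verifier accepts, when the input encodes the formula with the clauses `cl`. -/
def Accepts (s p q : ℕ) (hc : Option Bool) (cl : List (Clause × Option Bool)) : Prop :=
  (∃ i < p + q, InvalidAt s p (cl.map Prod.fst) i) ∨ (∃ D ∈ cl, ∃ k, p + q ≤ D.1 k) ∨
    (¬ ∃ i < p + q, BadAt p cl i) ∧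
      -- A coloured header adds a mark. This only makes acceptance harder, so soundness is
      -- unaffected.
      hc.toList.length + numColoured cl < ∑ i ∈ Finset.range p, colouredOcc i cl

open Classical in
theorem within_scan_all {p q : ℕ} {cl : List (Clause × Option Bool)} {hc : Option Bool}
    {v : Reg s} (hs : 0 < s)
    (h : LoopInv s p cl (List.replicate (hc.toList.length + numColoured cl) true) 0 v
      (List.replicate (hc.toList.length + numColoured cl) true)) (j n)
    (hj : j.length ≤ n) (hn : (tape 0 p q hc cl).length ≤ n)
    (hm : hc.toList.length + numColoured cl ≤ n) :
    Within s ((n + 2) * (2 * n + 2))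
      (cfg .scan v j [] (tape 0 p q hc cl)
        (List.replicate (hc.toList.length + numColoured cl) true))
      (outCfg s (decide (Accepts s p q hc cl))) := by
  obtain ⟨v', m', h', w⟩ := within_passes (q := q) hs h hc j (p + q) le_rfl
  have e1 : tapeAt (p + q) p q hc cl = header 0 0 hc ++ cl.flatMap (clauseSyms (p + q)) := by
    rw [tapeAt, tape, show p - (p + q) = 0 by omega, show q - (p + q - p) = 0 by omega]
  have w1 := scan_pass .final v' h'.sym h'.tally (p + q) cl (header 0 0 hc) (header 0 0 hc) j m'
      (fun r => scan_header_final v' h'.sym h'.head hc j [] r m')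
  rw [← e1, if_pos rfl] at w1
  have len := length_tapeAt_le (p + q) p q hc cl
  have len2 := length_flatMap_clauseSyms_succ_le (p + q) cl
  have len3 : (header 0 0 hc ++ cl.flatMap (clauseSyms (p + q + 1))).length ≤ n := by
    rw [e1] at len
    rw [List.length_append] at len ⊢
    omega
  have hmarks : ((v'.under, m') : Bool × List Bool) = _ := h'.marks
  rw [show min (p + q) p = p by omega] at hmarks
  have hst := passState_marks (s := s) .final (p + q) cl v'.under m'
  rw [if_neg (by simp), takeMarks_zero] at hst
  have hm' : m'.length ≤ n := by
    rw [(Prod.mk.inj hmarks).2]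
    simp
    omega
  have w2 := w1.trans (within_clear n (passReg .final (p + q) cl v' m') j _ [] _ hj
    (by rwa [List.length_reverse]) (by simp) (by rw [hst]; exact hm'))
  have hverdict : (passReg .final (p + q) cl v' m').verdict = decide (Accepts s p q hc cl) := by
    rw [Bool.eq_iff_iff, decide_eq_true_eq, Accepts, ← h'.invalid, ← h'.bad,
      ← passState_alive (s := s) .final (p + q) cl v'.under m']
    have hu : v'.under = true ↔
        hc.toList.length + numColoured cl < ∑ i ∈ Finset.range p, colouredOcc i cl := by
      rw [(Prod.mk.inj hmarks).1]
      simp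
    rw [← hu]
    simp [passReg, endPass, Reg.withState, hst, or_assoc]
  rw [hverdict] at w2
  refine (w.trans w2).mono ?_
  -- The header is in unary, so the number of passes is bounded by the length of the tape.
  have hpq : p + q + 2 ≤ n := by
    refine le_trans ?_ hn
    rw [tape, List.length_append, length_header]
    omega
  have : (p + q) * (2 * (tape 0 p q hc cl).length + 2) ≤ n * (2 * n + 2) :=
    Nat.mul_le_mul (by omega) (by omega)
  calc _ ≤ n * (2 * n + 2) + (n + 1 + (n + 1)) := by omega
    _ ≤ _ := by rw [Nat.add_mul]; omega

end Loop

/-! ### Arbitrary bit strings and the total running time -/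

section Verifier

variable {s : ℕ}

open MonotoneQBF (encodeNumeral)

theorem exists_numerals (x : List Bool) :
    ∃ (ns : List ℕ) (t : ℕ), x = ns.flatMap encodeNumeral ++ List.replicate t true := by
  induction x with
  | nil => exact ⟨[], 0, rfl⟩
  | cons b x ih =>
    obtain ⟨ns, t, rfl⟩ := ih
    cases b
    · exact ⟨0 :: ns, t, by simp [encodeNumeral]⟩
    · rcases ns with _ | ⟨n, ns⟩
      · exact ⟨[], t + 1, by simp [List.replicate_succ]⟩
      · exact ⟨(n + 1) :: ns, t, by simp [encodeNumeral, List.replicate_succ]⟩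

theorem count_false_encodeNumeral (n : ℕ) : (encodeNumeral n).count false = 1 := by
  simp [encodeNumeral, List.count_replicate]

theorem count_false_flatMap (ns : List ℕ) :
    (ns.flatMap encodeNumeral).count false = ns.length := by
  induction ns with
  | nil => simp
  | cons n ns ih => simp [ih, count_false_encodeNumeral, Nat.add_comm]

theorem exists_clauses (m : ℕ) (ns : List ℕ) (h : ns.length = 3 * m) :
    ∃ cl : List Clause, ns.flatMap encodeNumeral = cl.flatMap codeClause := by
  induction m generalizing ns with
  | zero =>
    rw [List.length_eq_zero_iff.1 h]
    exact ⟨[], rfl⟩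
  | succ m ih =>
    obtain _ | ⟨a, _ | ⟨b, _ | ⟨c, ns⟩⟩⟩ := ns
    · simp at h
    · simp at h; omega
    · simp at h; omega
    · obtain ⟨cl, hcl⟩ := ih ns (by simp at h; omega)
      exact ⟨![a, b, c] :: cl, by simp [hcl, codeClause]⟩

/-- Each numeral has exactly one `false`, at its end; two numerals form the header and three each
clause. This syntax test is all that is needed to recognise codes. -/
theorem exists_code {x : List Bool} (hlast : x.getLastD true = false)
    (hcount : x.count false % 3 = 2) : ∃ p q cl, x = code p q cl := by
  obtain ⟨ns, t, rfl⟩ := exists_numerals x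
  obtain rfl : t = 0 := by
    by_contra ht
    obtain ⟨t, rfl⟩ := Nat.exists_eq_succ_of_ne_zero ht
    rw [List.replicate_succ', ← List.append_assoc] at hlast
    simp at hlast
  simp only [List.replicate_zero, List.append_nil, count_false_flatMap] at hcount ⊢
  obtain _ | ⟨p, _ | ⟨q, ns⟩⟩ := ns
  · simp at hcount
  · simp at hcount
  · obtain ⟨cl, hcl⟩ := exists_clauses (ns.length / 3) ns (by simp at hcount; omega)
    exact ⟨p, q, cl, by simp [code, hcl]⟩

theorem getLastD_append_encodeNumeral (x : List Bool) (n : ℕ) (b : Bool) :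
    (x ++ encodeNumeral n).getLastD b = false := by
  rw [encodeNumeral, ← List.append_assoc]
  simp

theorem code_getLastD (p q : ℕ) (cl : List Clause) (b : Bool) :
    (code p q cl).getLastD b = false := by
  rcases List.eq_nil_or_concat cl with rfl | ⟨cl, C, rfl⟩
  · simp only [code, List.flatMap_nil, List.append_nil]
    exact getLastD_append_encodeNumeral _ _ _
  · have : code p q (cl.concat C) = (encodeNumeral p ++ (encodeNumeral q ++ (cl.flatMap codeClause
        ++ (encodeNumeral (C 0) ++ encodeNumeral (C 1))))) ++ encodeNumeral (C 2) := by
      simp [code, codeClause]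
    rw [this]
    exact getLastD_append_encodeNumeral _ _ _

open Classical in
/-- The relation that is computed by the verifier. -/
noncomputable def verify (s : ℕ) (xc : List Bool × List Bool) : Bool :=
  if h : ∃ t : ℕ × ℕ × List Clause, xc.1 = code t.1 t.2.1 t.2.2 then
    decide (Accepts s h.choose.1 h.choose.2.1 (headerColour h.choose.2.2 xc.2)
      (attach h.choose.2.2 xc.2).1)
  -- A string that is no code lies in the complement of the language.
  else true

/-- On strings that may not be codes, only the number of terminators modulo 3 and the stack heights
matter: the former decides the verdict, the latter bound the clearing time. -/
theorem merge_bits (x : List Bool) (v : Reg s) (hs : v.sym = none) (hb : v.bit = none)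
    (c : List Bool) (r m) :
    ∃ (v' : Reg s) (c' : List Bool) (r' : List Sym) (m' : List Bool),
      v'.pos.val = (v.pos.val + x.count false) % 3 ∧ c'.length ≤ c.length ∧
      r'.length ≤ r.length + x.length ∧ m'.length ≤ m.length + x.length ∧
      Within s x.length (cfg .merge v (c.map some) (x.map bitSym) r m)
        (cfg .merge v' (c'.map some) [] r' m') := by
  induction x generalizing v c r m with
  | nil =>
    exact ⟨v, c, r, m, by simp [Nat.mod_eq_of_lt v.pos.isLt], le_rfl, by simp, by simp, Within.refl _⟩
  | cons b x ih =>
    cases b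
    · by_cases hp : v.pos = 0
      · obtain ⟨v', c', r', m', e1, e2, e3, e4, w⟩ :=
          ih { v with pos := 1, colour := colourOf c.head? c.tail.head? } hs hb c.tail.tail
            (.term false (colourOf c.head? c.tail.head?) :: r)
            (List.replicate (colourOf c.head? c.tail.head?).toList.length true ++ m)
        refine ⟨v', c', r', m', ?_, ?_, ?_, ?_,
          ((merge_term_zero v hs hb hp false none c (x.map bitSym) r m).trans w).mono
            (Nat.add_comm 1 _).le⟩
        · simp only [e1, hp, List.count_cons_self, Fin.val_one, Fin.val_zero]
          omega
        · simp at e2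
          omega
        · simp at e3 ⊢
          omega
        · have : (colourOf c.head? c.tail.head?).toList.length ≤ 1 := by
            cases colourOf c.head? c.tail.head? <;> simp
          simp only [List.length_append, List.length_replicate, List.length_cons] at e4 ⊢
          omega
      · obtain ⟨v', c', r', m', e1, e2, e3, e4, w⟩ :=
          ih { v with pos := v.pos + 1 } hs hb c (.term (v.pos = 2) v.colour :: r) m
        refine ⟨v', c', r', m', ?_, e2, ?_, ?_,
          ((merge_term v hs hb hp false none (c.map some) (x.map bitSym) r m).trans w).mono
            (Nat.add_comm 1 _).le⟩
        · simp only [e1, List.count_cons_self]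
          rw [Fin.val_add, Fin.val_one]
          omega
        · simp at e3 ⊢
          omega
        · simp
          omega
    · obtain ⟨v', c', r', m', e1, e2, e3, e4, w⟩ := ih v hs hb c (.one :: r) m
      refine ⟨v', c', r', m', ?_, e2, ?_, ?_,
          ((merge_one v hs (c.map some) (x.map bitSym) r m).trans w).mono
            (Nat.add_comm 1 _).le⟩
      · simp [e1]
      · simp at e3 ⊢
        omega
      · simp
        omega

theorem length_tape_zero (p q : ℕ) (hc : Option Bool) (cl : List (Clause × Option Bool)) :
    (tape 0 p q hc cl).length = (code p q (cl.map Prod.fst)).length := by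
  have : (cl.flatMap (clauseSyms 0)).length = ((cl.map Prod.fst).flatMap codeClause).length := by
    induction cl with
    | nil => rfl
    | cons D cl ih =>
      simp only [List.flatMap_cons, List.map_cons, List.length_append, ih, clauseSyms, codeClause,
        length_encodeNumeral, numeralSyms]
      simp
  simp only [tape, code, List.length_append, length_header, length_encodeNumeral, this]
  omega

theorem attach_map_fst (cl : List Clause) (c : List Bool) :
    (attach cl c).1.map Prod.fst = cl := by
  induction cl with
  | nil => rfl
  | cons C cl ih => simp [attach, ih]

theorem length_attach_snd (cl : List Clause) (c : List Bool) :
    (attach cl c).2.length ≤ c.length := by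
  induction cl with
  | nil => exact le_rfl
  | cons C cl ih =>
    simp only [attach, List.length_tail]
    omega

theorem length_le_length_code (p q : ℕ) (cl : List Clause) :
    cl.length + 2 ≤ (code p q cl).length := by
  have : cl.length ≤ (cl.flatMap codeClause).length := by
    induction cl with
    | nil => simp
    | cons C cl ih =>
      simp only [List.flatMap_cons, List.length_append, codeClause, length_encodeNumeral,
        List.length_cons]
      omega
  simp only [code, List.length_append, length_encodeNumeral]
  omega

theorem encodePair_length (x c : List Bool) :
    (encodePair (x, c)).length = x.length + c.length + 1 := by
  simp [encodePair]
  omega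

theorem within_verify (hs : 0 < s) (x c : List Bool) (n : ℕ)
    (hn : (encodePair (x, c)).length = n) :
    Within s (2 * n + (n + 2) * (2 * n + 2))
      (cfg .read {} (encodePair (x, c)) [] [] []) (outCfg s (verify s (x, c))) := by
  rw [encodePair_length] at hn
  have w1 := (within_read x (none :: c.map some) ({} : Reg s) rfl [] [] []).trans
    (within_read_end _ _ rfl _ _ _)
  rw [List.append_nil] at w1
  have hmul : n + 1 ≤ (n + 2) * (2 * n + 2) := by nlinarith
  by_cases h : ∃ t : ℕ × ℕ × List Clause, x = code t.1 t.2.1 t.2.2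
  · rw [verify, dif_pos h]
    generalize ht : h.choose = t
    have hx : x = code t.1 t.2.1 t.2.2 := ht ▸ h.choose_spec
    obtain ⟨p, q, cl⟩ := t
    dsimp only at hx ⊢
    have hlast : x.getLastD true = false := by rw [hx, code_getLastD]
    simp only [hlast] at w1
    subst hx
    have w2 := w1.trans
      (within_merge p q cl ({ last := false } : Reg s) rfl rfl rfl rfl rfl c)
    have hfst := attach_map_fst cl c
    have hcol : (headerColour cl c).toList.length ≤ 1 := by
      cases headerColour cl c <;> simp
    have hnum : numColoured (attach cl c).1 ≤ cl.length := by
      refine List.countP_le_length.trans_eq ?_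
      rw [← List.length_map (f := Prod.fst), hfst]
    have hlen := length_le_length_code p q cl
    have hrest := length_attach_snd cl c
    refine (w2.trans (within_scan_all hs ?_ _ n ?_ ?_ ?_)).mono ?_
    · exact ⟨rfl, rfl, rfl, by simp, by simp, by simp [takeMarks_zero]⟩
    · simp
      omega
    · rw [length_tape_zero, hfst]
      omega
    · omega
    · omega
  · rw [verify, dif_neg h]
    by_cases hlast : x.getLastD true = true
    · simp only [hlast, if_true] at w1
      refine (w1.trans (within_clear n _ _ _ _ _ ?_ ?_ ?_ ?_)).mono ?_ <;>
        (try simp) <;> omega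
    · rw [Bool.not_eq_true] at hlast
      simp only [hlast] at w1
      obtain ⟨v', c', r', m', e1, e2, e3, e4, w⟩ := merge_bits x.reverse
        ({ last := false } : Reg s) rfl rfl c [] []
      rw [← List.map_reverse] at w1
      have hpos : v'.pos ≠ 2 := by
        intro hp
        refine h ?_
        obtain ⟨p, q, cl, hx⟩ := exists_code hlast (by
          rw [hp, List.count_reverse] at e1
          simpa using e1.symm)
        exact ⟨(p, q, cl), hx⟩
      have w2 := (w1.trans w).trans (merge_end _ _ _ _)
      simp only [if_neg hpos, decide_eq_true hpos] at w2
      simp at e2 e3 e4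
      refine (w2.trans (within_clear n _ _ _ _ _ ?_ ?_ ?_ ?_)).mono ?_ <;>
        (try simp) <;> omega

end Verifier

/-! ### The verifier as a polynomial-time computation -/

section Computable

variable {s : ℕ}

theorem initList_verifier (l : List (Option Bool)) :
    initList (verifier s) l = (cfg .read {} l [] [] [] : VCfg s) := by
  refine congrArg (TM2.Cfg.mk _ _) ?_
  funext k
  cases k <;> rfl

theorem haltList_verifier (b : Bool) :
    haltList (verifier s) [b] = outCfg s b := by
  refine congrArg (TM2.Cfg.mk _ _) ?_
  funext k
  cases k <;> rfl

open Polynomial in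
/-- The verifier runs in polynomial time. -/
noncomputable def verifyComputable (hs : 0 < s) :
    TM2ComputableInPolyTime encodePair encodeBool (verify s) where
  tm := verifier s
  inputAlphabet := Equiv.refl (Option Bool)
  outputAlphabet := Equiv.refl Bool
  time := 2 * X + (X + 2) * (2 * X + 2)
  outputsFun xc := by
    refine Classical.choice ?_
    obtain ⟨k, hk, h⟩ := within_verify hs xc.1 xc.2 _ rfl
    rw [← initList_verifier, ← haltList_verifier] at h
    have e : List.map (Equiv.refl (Option Bool)).invFun (encodePair xc) = encodePair xc := by
      simp
    have e' : List.map (Equiv.refl Bool).invFun (encodeBool (verify s xc)) = [verify s xc] := by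
      simp [encodeBool]
    refine ⟨⟨⟨k, Eq.trans ?_ (h.trans ?_)⟩, hk.trans (le_of_eq ?_)⟩⟩
    · exact congrArg (fun l => (flip bind (TM2.step (prog s)))^[k]
        (some (initList (verifier s) l))) e
    · exact congrArg (fun l => some (haltList (verifier s) l)) e'.symm
    · simp

end Computable

/-! ### Unique decoding, and formulas in terms of natural numbers -/

section Codes

open MonotoneQBF (encodeNumeral)

/-- Numerals form a prefix code, from which the injectivity of `code` follows. -/
theorem encodeNumeral_append_inj {a b : ℕ} {x y : List Bool}
    (h : encodeNumeral a ++ x = encodeNumeral b ++ y) : a = b ∧ x = y := by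
  induction a generalizing b with
  | zero => cases b <;> simp_all [encodeNumeral, List.replicate_succ]
  | succ a ih =>
    cases b with
    | zero => simp [encodeNumeral, List.replicate_succ] at h
    | succ b =>
      have := ih (b := b) (by simpa [encodeNumeral, List.replicate_succ] using h)
      exact ⟨by rw [this.1], this.2⟩

theorem codeClause_append_inj {C D : Clause} {x y : List Bool}
    (h : codeClause C ++ x = codeClause D ++ y) : C = D ∧ x = y := by
  simp only [codeClause, List.append_assoc] at h
  obtain ⟨h0, h⟩ := encodeNumeral_append_inj h
  obtain ⟨h1, h⟩ := encodeNumeral_append_inj h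
  obtain ⟨h2, h⟩ := encodeNumeral_append_inj h
  refine ⟨?_, h⟩
  funext k
  fin_cases k <;> assumption

theorem codeClause_ne_nil (C : Clause) : codeClause C ≠ [] := by
  simp [codeClause, encodeNumeral]

theorem flatMap_codeClause_inj {cl cl' : List Clause}
    (h : cl.flatMap codeClause = cl'.flatMap codeClause) : cl = cl' := by
  induction cl generalizing cl' with
  | nil =>
    cases cl' with
    | nil => rfl
    | cons C cl' => simp [codeClause_ne_nil] at h
  | cons C cl ih =>
    cases cl' with
    | nil => simp [codeClause_ne_nil] at h
    | cons D cl' =>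
      obtain ⟨rfl, h'⟩ := codeClause_append_inj (by simpa using h)
      rw [ih h']

theorem code_inj {p q p' q' : ℕ} {cl cl' : List Clause} (h : code p q cl = code p' q' cl') :
    p = p' ∧ q = q' ∧ cl = cl' := by
  obtain ⟨h0, h⟩ := encodeNumeral_append_inj h
  obtain ⟨h1, h⟩ := encodeNumeral_append_inj h
  exact ⟨h0, h1, flatMap_codeClause_inj h⟩

/-- A certificate for a colouring of the clauses. -/
def certificate : List (Clause × Option Bool) → List Bool
  | [] => []
  -- The bits of the head clause come last because `attach` colours from the last clause to the
  -- first.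
  | D :: cl => certificate cl ++ [D.2.isSome, D.2.getD false]

theorem attach_certificate (cl : List (Clause × Option Bool)) (t : List Bool) :
    attach (cl.map Prod.fst) (certificate cl ++ t) = (cl, t) := by
  induction cl generalizing t with
  | nil => rfl
  | cons D cl ih =>
    obtain ⟨C, c⟩ := D
    simp only [certificate, List.map_cons, attach, List.append_assoc, ih]
    rcases c with _ | _ | _ <;> simp [colourOf]

theorem length_certificate (cl : List (Clause × Option Bool)) :
    (certificate cl).length = 2 * cl.length := by
  induction cl with
  | nil => rfl
  | cons D cl ih =>
    simp [certificate, ih]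
    omega

/-- The clauses of a formula, as triples of natural numbers. -/
def MonotoneQBF.clausesVal (Φ : MonotoneQBF) : List Clause :=
  Φ.clauses.map fun C k => (C k).val

theorem MonotoneQBF.encode_eq (Φ : MonotoneQBF) :
    Φ.encode = code Φ.numUniv Φ.numExist Φ.clausesVal := by
  have h : ∀ l : List (Fin 3 → Fin (Φ.numUniv + Φ.numExist)),
      (l.flatMap List.ofFn).flatMap (fun i : Fin _ => encodeNumeral i.val)
        = (l.map fun (C : Fin 3 → Fin _) k => (C k).val).flatMap codeClause := by
    intro l
    induction l with
    | nil => rfl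
    | cons C l ih =>
      rw [List.flatMap_cons, List.flatMap_append, ih]
      simp [codeClause, List.ofFn_succ]
  simp only [encode, code, clausesVal, appearances, List.append_assoc]
  rw [h]

theorem MonotoneQBF.count_appearances (Φ : MonotoneQBF) (i : Fin (Φ.numUniv + Φ.numExist)) :
    Φ.appearances.count i = occ i.val Φ.clausesVal := by
  have h : ∀ l : List (Fin 3 → Fin (Φ.numUniv + Φ.numExist)),
      (l.flatMap List.ofFn).count i = occ i.val (l.map fun (C : Fin 3 → Fin _) k => (C k).val) := by
    intro l
    induction l with
    | nil => rfl
    | cons C l ih =>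
      rw [List.flatMap_cons, List.count_append, ih]
      simp only [occ, List.map_cons, List.sum_cons, hits_eq, List.ofFn_succ, List.ofFn_zero,
        List.count_cons, List.count_nil, beq_iff_eq, ← Fin.ext_iff]
      simp
      omega
  exact h _

/-- Correctness of the input, in terms of natural numbers. -/
structure ValidInput (s p q : ℕ) (cl : List Clause) : Prop where
  lt : ∀ C ∈ cl, ∀ k, C k < p + q
  injective : ∀ C ∈ cl, Function.Injective C
  univ : ∀ i < p, occ i cl = s
  exist : ∀ i, p ≤ i → i < p + q → occ i cl = 2

theorem MonotoneQBF.IsInput.validInput {Φ : MonotoneQBF} {s : ℕ} (h : Φ.IsInput s 2) :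
    ValidInput s Φ.numUniv Φ.numExist Φ.clausesVal where
  lt C hC k := by
    obtain ⟨C', _, rfl⟩ := List.mem_map.1 hC
    exact (C' k).isLt
  injective C hC := by
    obtain ⟨C', hC', rfl⟩ := List.mem_map.1 hC
    exact Fin.val_injective.comp (h.1 C' hC')
  univ i hi := by
    rw [← h.2.1 ⟨i, hi⟩, count_appearances]
    rfl
  exist i hi hi' := by
    rw [← h.2.2 ⟨i - Φ.numUniv, by omega⟩, count_appearances]
    congr 1
    simp
    omega

theorem ValidInput.exists_formula {s p q : ℕ} {cl : List Clause} (h : ValidInput s p q cl) :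
    ∃ Φ : MonotoneQBF, Φ.IsInput s 2 ∧ Φ.numUniv = p ∧ Φ.numExist = q ∧ Φ.clausesVal = cl := by
  let Φ : MonotoneQBF := ⟨p, q, cl.attach.map fun C k => ⟨C.1 k, h.lt C.1 C.2 k⟩⟩
  have hv : Φ.clausesVal = cl := by
    simp only [MonotoneQBF.clausesVal, Φ, List.map_map, Function.comp_def]
    exact List.attach_map_subtype_val cl
  refine ⟨Φ, ⟨?_, ?_, ?_⟩, rfl, rfl, hv⟩
  · intro C hC
    obtain ⟨C', _, rfl⟩ := List.mem_map.1 hC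
    intro a b hab
    exact h.injective C'.1 C'.2 (congrArg Fin.val hab)
  · intro i
    rw [Φ.count_appearances, hv]
    exact h.univ i i.isLt
  · intro i
    rw [Φ.count_appearances, hv]
    exact h.exist _ (Nat.le_add_right _ _) (Nat.add_lt_add_left i.isLt p)

/-- Whether the formula is a yes-instance, in terms of natural numbers. -/
def IsYesVal (p : ℕ) (cl : List Clause) : Prop :=
  ∀ β : ℕ → Bool, ∃ γ : ℕ → Bool, (∀ i < p, γ i = β i) ∧
    ∀ C ∈ cl, (∃ k, γ (C k) = true) ∧ ∃ k, γ (C k) = false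

theorem MonotoneQBF.isYes_iff (Φ : MonotoneQBF) : Φ.IsYes ↔ IsYesVal Φ.numUniv Φ.clausesVal := by
  constructor
  · intro h β
    obtain ⟨γ, hγ⟩ := h fun i => β i
    refine ⟨fun n => if hn : n < Φ.numUniv + Φ.numExist then
      Fin.append (fun i : Fin Φ.numUniv => β i) γ ⟨n, hn⟩ else false, ?_, ?_⟩
    · intro i hi
      have hn : i < Φ.numUniv + Φ.numExist := by omega
      simp only [hn, dif_pos]
      exact Fin.append_left (fun i : Fin Φ.numUniv => β i) γ ⟨i, hi⟩
    · intro C hC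
      obtain ⟨C', hC', rfl⟩ := List.mem_map.1 hC
      simpa [NAESatisfied] using hγ C' hC'
  · intro h β
    obtain ⟨γ, hγ, hcl⟩ := h fun n => if hn : n < Φ.numUniv then β ⟨n, hn⟩ else false
    refine ⟨fun j => γ (Φ.numUniv + j), ?_⟩
    have key : ∀ i, Fin.append β (fun j : Fin Φ.numExist => γ (Φ.numUniv + j)) i = γ i := by
      intro i
      refine Fin.addCases (fun i => ?_) (fun i => ?_) i
      · rw [Fin.append_left, Fin.val_castAdd, hγ i i.isLt]
        simp
      · rw [Fin.append_right, Fin.val_natAdd]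
    intro C hC
    simpa [NAESatisfied, key] using hcl _ (List.mem_map_of_mem hC)

theorem mem_language_iff (s p q : ℕ) (cl : List Clause) :
    code p q cl ∈ MonotoneForallExistsNAE3SAT s 2 ↔ ValidInput s p q cl ∧ IsYesVal p cl := by
  constructor
  · rintro ⟨Φ, hI, hY, h⟩
    rw [Φ.encode_eq] at h
    obtain ⟨rfl, rfl, rfl⟩ := code_inj h
    exact ⟨hI.validInput, Φ.isYes_iff.1 hY⟩
  · rintro ⟨hI, hY⟩
    obtain ⟨Φ, h, rfl, rfl, rfl⟩ := hI.exists_formula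
    exact ⟨Φ, h, Φ.isYes_iff.2 hY, Φ.encode_eq.symm⟩

end Codes

/-! ### Accepted colourings correspond to obstructions -/

section Correctness

/-- The set of variables of a clause. -/
def clauseVars (C : Clause) : Finset ℕ := Finset.univ.image C

theorem mem_clauseVars {C : Clause} {i : ℕ} : i ∈ clauseVars C ↔ ∃ k, C k = i := by
  simp [clauseVars]

theorem hits_eq_ite {C : Clause} (h : Function.Injective C) (i : ℕ) :
    hits i C = if i ∈ clauseVars C then 1 else 0 := by
  split_ifs with hi
  · obtain ⟨k, rfl⟩ := mem_clauseVars.1 hi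
    rw [hits, Finset.card_eq_one]
    exact ⟨k, by ext j; simp [h.eq_iff]⟩
  · rw [hits, Finset.card_eq_zero, Finset.filter_eq_empty_iff]
    exact fun k _ hk => hi (mem_clauseVars.2 ⟨k, hk⟩)

theorem hits_le_one_iff {C : Clause} : (∀ i, hits i C ≤ 1) ↔ Function.Injective C := by
  refine ⟨fun h a b hab => ?_, fun h i => ?_⟩
  · refine Finset.card_le_one.1 (h (C b)) a ?_ b ?_ <;> simp [hab]
  · rw [hits_eq_ite h]
    split_ifs <;> simp

/-- Checking repetitions only for variables below `p + q` suffices, because the range check excludes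
all others. -/
theorem validInput_iff {s p q : ℕ} {cl : List Clause} :
    ValidInput s p q cl ↔
      ¬ ((∃ i < p + q, InvalidAt s p cl i) ∨ ∃ C ∈ cl, ∃ k, p + q ≤ C k) := by
  constructor
  · rintro h (⟨i, hi, hocc | ⟨C, hC, h2⟩⟩ | ⟨C, hC, k, hk⟩)
    · split_ifs at hocc with hp
      · exact hocc (h.univ i hp)
      · exact hocc (h.exist i (by omega) hi)
    · have := hits_le_one_iff.2 (h.injective C hC) i
      omega
    · have := h.lt C hC k
      omega
  · intro h
    simp only [InvalidAt, not_or, not_exists, not_and, not_le, ne_eq, not_not] at h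
    obtain ⟨h1, h2⟩ := h
    refine ⟨h2, fun C hC => hits_le_one_iff.1 fun i => ?_, fun i hi => ?_, fun i hi hi' => ?_⟩
    · by_cases hi : i < p + q
      · have := (h1 i hi).2 C hC
        omega
      · have : hits i C = 0 := by
          rw [hits, Finset.card_eq_zero, Finset.filter_eq_empty_iff]
          intro k _ hk
          have := h2 C hC k
          omega
        omega
    · rw [(h1 i (by omega)).1, if_pos hi]
    · rw [(h1 i hi').1, if_neg (by omega)]

variable {s p q n : ℕ} {C : Fin n → Clause}

theorem ValidInput.card_filter_mem (h : ValidInput s p q (List.ofFn C)) (i : ℕ) :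
    (Finset.univ.filter fun D => i ∈ clauseVars (C D)).card = occ i (List.ofFn C) := by
  rw [occ, List.map_ofFn, List.sum_ofFn, Finset.card_filter]
  exact Finset.sum_congr rfl fun D _ =>
    (hits_eq_ite (h.injective _ (List.mem_ofFn.2 ⟨D, rfl⟩)) i).symm

theorem ValidInput.card_filter_mem_of_mem (h : ValidInput s p q (List.ofFn C)) :
    ∀ y ∈ Finset.Ico p (p + q),
      (Finset.univ.filter fun D => y ∈ clauseVars (C D)).card = 2 := by
  intro y hy
  rw [Finset.mem_Ico] at hy
  rw [h.card_filter_mem, h.exist y hy.1 hy.2]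

theorem ValidInput.card_clauseVars (h : ValidInput s p q (List.ofFn C)) (D : Fin n) :
    (clauseVars (C D)).card = 3 := by
  rw [clauseVars, Finset.card_image_of_injective _ (h.injective _ (List.mem_ofFn.2 ⟨D, rfl⟩))]
  simp

theorem ValidInput.mem_lt (h : ValidInput s p q (List.ofFn C)) {D : Fin n} {y : ℕ}
    (hy : y ∈ clauseVars (C D)) : y < p + q := by
  obtain ⟨k, rfl⟩ := mem_clauseVars.1 hy
  exact h.lt _ (List.mem_ofFn.2 ⟨D, rfl⟩) k

/-- The list of the clauses `C`, coloured by `col`. -/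
def colourList (C : Fin n → Clause) (col : Fin n → Option Bool) : List (Clause × Option Bool) :=
  List.ofFn fun D => (C D, col D)

variable {col : Fin n → Option Bool}

/-- The indices of the coloured clauses. -/
def colouredSet (col : Fin n → Option Bool) : Finset (Fin n) :=
  Finset.univ.filter fun D => (col D).isSome = true

theorem mem_colouredSet {D : Fin n} : D ∈ colouredSet col ↔ (col D).isSome = true := by
  simp [colouredSet]

theorem numColoured_colourList : numColoured (colourList C col) = (colouredSet col).card := by
  have h : ∀ l : List (Clause × Option Bool),
      numColoured l = (l.map fun D => if D.2.isSome = true then 1 else 0).sum := by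
    intro l
    induction l with
    | nil => rfl
    | cons D l ih =>
      simp only [numColoured, List.countP_cons, List.map_cons, List.sum_cons] at ih ⊢
      rw [ih, Nat.add_comm]
  rw [h, colourList, List.map_ofFn, List.sum_ofFn, colouredSet, Finset.card_filter]
  rfl

theorem ValidInput.colouredOcc_eq (h : ValidInput s p q (List.ofFn C)) (i : ℕ) :
    colouredOcc i (colourList C col)
      = ((colouredSet col).filter fun D => i ∈ clauseVars (C D)).card := by
  rw [colouredOcc, colourList, List.map_ofFn, List.sum_ofFn, colouredSet, Finset.filter_filter,
    Finset.card_filter]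
  refine Finset.sum_congr rfl fun D _ => ?_
  have := hits_eq_ite (h.injective _ (List.mem_ofFn.2 ⟨D, rfl⟩)) i
  by_cases h1 : (col D).isSome = true <;> by_cases h2 : i ∈ clauseVars (C D) <;> simp_all

/-- Universal and existential variables in coloured clauses add up to three per clause, so fewer
than two existential ones on average means more than one universal one. The latter form suits the
marks. -/
theorem ValidInput.count_iff (h : ValidInput s p q (List.ofFn C)) :
    ∑ D ∈ colouredSet col, (Finset.Ico p (p + q) ∩ clauseVars (C D)).card
        < 2 * (colouredSet col).card ↔
      numColoured (colourList C col) < ∑ i ∈ Finset.range p, colouredOcc i (colourList C col) := by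
  have h1 : ∑ i ∈ Finset.range p, colouredOcc i (colourList C col)
      = ∑ D ∈ colouredSet col, (Finset.range p ∩ clauseVars (C D)).card := by
    rw [sum_card_inter_eq]
    exact Finset.sum_congr rfl fun i _ => h.colouredOcc_eq i
  have h2 : ∑ D ∈ colouredSet col, (Finset.range p ∩ clauseVars (C D)).card
      + ∑ D ∈ colouredSet col, (Finset.Ico p (p + q) ∩ clauseVars (C D)).card
      = 3 * (colouredSet col).card := by
    rw [← Finset.sum_add_distrib, Finset.sum_congr rfl (g := fun _ => 3), Finset.sum_const,
      smul_eq_mul, Nat.mul_comm]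
    intro D _
    rw [← h.card_clauseVars D, ← Finset.card_union_of_disjoint]
    · congr 1
      ext y
      simp only [Finset.mem_union, Finset.mem_inter, Finset.mem_range, Finset.mem_Ico]
      constructor
      · rintro (h | h) <;> exact h.2
      · intro hy
        have := h.mem_lt hy
        by_cases hp : y < p
        · exact Or.inl ⟨hp, hy⟩
        · exact Or.inr ⟨⟨by omega, this⟩, hy⟩
    · rw [Finset.disjoint_left]
      intro y h1 h2
      simp only [Finset.mem_inter, Finset.mem_range, Finset.mem_Ico] at h1 h2
      omega
  rw [h1, numColoured_colourList]
  omega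

theorem seen_colourList (i : ℕ) (c : Option Bool) :
    (∃ D ∈ colourList C col, D.2 = c ∧ ∃ k, D.1 k = i) ↔
      ∃ D, col D = c ∧ i ∈ clauseVars (C D) := by
  simp [colourList, List.mem_ofFn, mem_clauseVars]

/-- A colouring that is not bad anywhere yields an obstruction. -/
theorem ValidInput.obstruction (h : ValidInput s p q (List.ofFn C))
    (hbad : ¬ ∃ i < p + q, BadAt p (colourList C col) i)
    (hcount : numColoured (colourList C col)
      < ∑ i ∈ Finset.range p, colouredOcc i (colourList C col)) :
    ∃ β, Obstruction (fun D => clauseVars (C D)) (Finset.Ico p (p + q)) β (colouredSet col)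
      (fun D => (col D).getD false) := by
  classical
  have hcol : ∀ {D}, D ∈ colouredSet col → col D = some ((col D).getD false) := by
    intro D hD
    rw [mem_colouredSet] at hD
    obtain ⟨b, hb⟩ := Option.isSome_iff_exists.1 hD
    simp [hb]
  replace hbad : ∀ i < p + q, ¬ BadAt p (colourList C col) i := fun i hi hb => hbad ⟨i, hi, hb⟩
  simp only [BadAt, seen_colourList] at hbad
  -- The universal assignment is recovered from the colours; it is consistent because no universal
  -- variable sees both.
  refine ⟨fun y => decide (∃ D, col D = some true ∧ y ∈ clauseVars (C D)), ?_, ?_, ?_,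
    h.count_iff.2 hcount⟩
  · intro D hD y hy hyU
    have hlt := h.mem_lt hy
    have hp : y < p := by
      by_contra hp
      exact hyU (Finset.mem_Ico.2 ⟨by omega, hlt⟩)
    have hb := hbad y hlt
    rw [if_pos hp] at hb
    have hc := hcol hD
    rcases hd : (col D).getD false <;> rw [hd] at hc
    · rw [decide_eq_false_iff_not]
      rintro ⟨D', hD', hy'⟩
      exact hb ⟨⟨D', hD', hy'⟩, ⟨D, hc, hy⟩⟩
    · rw [decide_eq_true_eq]
      exact ⟨D, hc, hy⟩
  · intro D hD y hy hyU D' hy'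
    rw [Finset.mem_Ico] at hyU
    have hb := hbad y hyU.2
    rw [if_neg (by omega), not_not] at hb
    have hc := hcol hD
    rw [mem_colouredSet, ← Option.ne_none_iff_isSome]
    intro hnone
    rcases hb with ⟨h1, h2⟩ | ⟨h1, -, -⟩
    · rcases hd : (col D).getD false <;> rw [hd] at hc
      · exact h2 ⟨D, hc, hy⟩
      · exact h1 ⟨D, hc, hy⟩
    · exact h1 ⟨D', hnone, hy'⟩
  · intro D hD D' hD' hne y hy hy' hyU heq
    have h2 := h.card_filter_mem_of_mem y hyU
    rw [Finset.mem_Ico] at hyU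
    have hb := hbad y hyU.2
    rw [if_neg (by omega), not_not] at hb
    have hc := hcol hD
    have hc' := hcol hD'
    rw [← heq] at hc'
    -- If `D` and `D'` had the same colour, the opposite one would have to occur in a third clause
    -- through `y`.
    have hother : ∃ D'', col D'' = some (!(col D).getD false) ∧ y ∈ clauseVars (C D'') := by
      rcases hb with ⟨h1, h2⟩ | ⟨-, h1, h2⟩
      · rcases hd : (col D).getD false <;> rw [hd] at hc
        · exact (h2 ⟨D, hc, hy⟩).elim
        · exact (h1 ⟨D, hc, hy⟩).elim
      · cases (col D).getD false
        · exact h1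
        · exact h2
    obtain ⟨D'', hc'', hy''⟩ := hother
    have n1 : D'' ≠ D := by
      rintro rfl
      rw [hc] at hc''
      simp at hc''
    have n2 : D'' ≠ D' := by
      rintro rfl
      rw [hc'] at hc''
      simp at hc''
    have h3 : ({D'', D, D'} : Finset (Fin n)).card ≤
        (Finset.univ.filter fun D => y ∈ clauseVars (C D)).card := by
      refine Finset.card_le_card ?_
      intro E hE
      simp only [Finset.mem_insert, Finset.mem_singleton] at hE
      rcases hE with rfl | rfl | rfl <;> simpa
    rw [h2, Finset.card_eq_three.2 ⟨D'', D, D', n1, n2, hne, rfl⟩] at h3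
    omega

/-- The colouring that belongs to an obstruction. -/
def obstructionColour (T : Finset (Fin n)) (d : Fin n → Bool) (D : Fin n) : Option Bool :=
  if D ∈ T then some (d D) else none

theorem obstructionColour_eq_some {T : Finset (Fin n)} {d : Fin n → Bool} {D : Fin n} {b : Bool} :
    obstructionColour T d D = some b ↔ D ∈ T ∧ d D = b := by
  simp [obstructionColour]

theorem obstructionColour_eq_none {T : Finset (Fin n)} {d : Fin n → Bool} {D : Fin n} :
    obstructionColour T d D = none ↔ D ∉ T := by
  simp [obstructionColour]

theorem colouredSet_obstructionColour (T : Finset (Fin n)) (d : Fin n → Bool) :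
    colouredSet (obstructionColour T d) = T := by
  ext D
  rw [mem_colouredSet, ← Option.ne_none_iff_isSome, ne_eq, obstructionColour_eq_none, not_not]

/-- A universal variable cannot see two colours, as both would equal its value. An existential
variable touched by `T` has both clauses in `T` by closedness, with opposite colours by alternation.
-/
theorem ValidInput.not_badAt (h : ValidInput s p q (List.ofFn C)) {β : ℕ → Bool}
    {T : Finset (Fin n)} {d : Fin n → Bool}
    (ho : Obstruction (fun D => clauseVars (C D)) (Finset.Ico p (p + q)) β T d) :
    ¬ ∃ i < p + q, BadAt p (colourList C (obstructionColour T d)) i := by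
  rintro ⟨i, hi, hb⟩
  simp only [BadAt, seen_colourList, obstructionColour_eq_some, obstructionColour_eq_none] at hb
  split_ifs at hb with hp
  · obtain ⟨⟨D, ⟨hD, hd⟩, hiD⟩, ⟨D', ⟨hD', hd'⟩, hiD'⟩⟩ := hb
    have hU : i ∉ Finset.Ico p (p + q) := by
      rw [Finset.mem_Ico]
      omega
    have e := ho.fixed D hD i hiD hU
    have e' := ho.fixed D' hD' i hiD' hU
    rw [e, hd, hd'] at e'
    exact absurd e' (by simp)
  · refine hb ?_
    have hU : i ∈ Finset.Ico p (p + q) := Finset.mem_Ico.2 ⟨by omega, hi⟩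
    by_cases hex : ∃ D ∈ T, i ∈ clauseVars (C D)
    · right
      obtain ⟨D, hD, hiD⟩ := hex
      have hother : ∃ D', D ≠ D' ∧ i ∈ clauseVars (C D') := by
        obtain ⟨D', hD', hne⟩ := Finset.exists_mem_ne
          (by rw [h.card_filter_mem_of_mem i hU]; omega) D
        exact ⟨D', hne.symm, (Finset.mem_filter.1 hD').2⟩
      obtain ⟨D', hne, hiD'⟩ := hother
      have hD' := ho.closed D hD i hiD hU D' hiD'
      have hd := ho.alternating D hD D' hD' hne i hiD hiD' hU
      refine ⟨?_, ?_⟩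
      · rintro ⟨E, hE, hiE⟩
        exact hE (ho.closed D hD i hiD hU E hiE)
      · cases e : d D <;> cases e' : d D'
        · exact absurd (e.trans e'.symm) hd
        · exact ⟨⟨D', ⟨hD', e'⟩, hiD'⟩, ⟨D, ⟨hD, e⟩, hiD⟩⟩
        · exact ⟨⟨D, ⟨hD, e⟩, hiD⟩, ⟨D', ⟨hD', e'⟩, hiD'⟩⟩
        · exact absurd (e.trans e'.symm) hd
    · left
      push Not at hex
      exact ⟨fun ⟨D, hD, hiD⟩ => hex D hD.1 hiD, fun ⟨D, hD, hiD⟩ => hex D hD.1 hiD⟩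

theorem naeFamily_clauseVars {γ : ℕ → Bool} : NAEFamily (fun D => clauseVars (C D)) γ ↔
    ∀ C' ∈ List.ofFn C, (∃ k, γ (C' k) = true) ∧ ∃ k, γ (C' k) = false := by
  simp [NAEFamily, clauseVars]

theorem colourList_map_fst : (colourList C col).map Prod.fst = List.ofFn C := by
  rw [colourList, List.map_ofFn]
  rfl

theorem colourList_get (cl : List (Clause × Option Bool)) :
    colourList (fun D => (cl.get D).1) (fun D => (cl.get D).2) = cl :=
  List.ofFn_get cl

/-- An accepted colouring witnesses that a valid input is a no-instance. -/
theorem ValidInput.not_isYesVal_of_accepts {cl : List (Clause × Option Bool)} {hc : Option Bool}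
    (h : ValidInput s p q (cl.map Prod.fst)) (ha : Accepts s p q hc cl) :
    ¬ IsYesVal p (cl.map Prod.fst) := by
  rcases ha with ha | ha | ⟨hb, hcount⟩
  · exact absurd (Or.inl ha) (validInput_iff.1 h)
  · exact absurd (Or.inr (by simpa using ha)) (validInput_iff.1 h)
  · rw [← colourList_get cl] at h hb hcount ⊢
    rw [colourList_map_fst] at h ⊢
    obtain ⟨β, ho⟩ := h.obstruction hb (by omega)
    intro hyes
    obtain ⟨γ, hγ, hcl⟩ := hyes β
    have hU := h.card_filter_mem_of_mem
    -- Numbers from `p + q` on are not variables but lie outside `U`, so `γ` is changed there to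
    -- agree with `β`.
    refine ho.not_naeFamily hU (γ := fun y => if y < p + q then γ y else β y) (fun y hy => ?_) ?_
    · rw [Finset.mem_Ico] at hy
      split_ifs with hlt
      · exact hγ y (by omega)
      · rfl
    · intro D
      obtain ⟨⟨y, hy, h1⟩, ⟨z, hz, h2⟩⟩ := naeFamily_clauseVars.2 hcl D
      exact ⟨⟨y, hy, by simp only [if_pos (h.mem_lt hy), h1]⟩,
        ⟨z, hz, by simp only [if_pos (h.mem_lt hz), h2]⟩⟩

/-- A no-instance has an accepted colouring. -/
theorem ValidInput.exists_accepts {cl : List Clause} (h : ValidInput s p q cl)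
    (hno : ¬ IsYesVal p cl) :
    ∃ ccl : List (Clause × Option Bool), ccl.map Prod.fst = cl ∧ Accepts s p q none ccl := by
  obtain ⟨n, C, rfl⟩ : ∃ n, ∃ C : Fin n → Clause, cl = List.ofFn C :=
    ⟨_, _, (List.ofFn_get cl).symm⟩
  simp only [IsYesVal, not_forall] at hno
  obtain ⟨β, hβ⟩ := hno
  rcases exists_naeFamily_or_obstruction h.card_clauseVars (Finset.Ico p (p + q))
    h.card_filter_mem_of_mem β with ⟨γ, hγ, hS⟩ | ⟨T, d, ho⟩
  · refine absurd ⟨γ, fun i hi => hγ i ?_, naeFamily_clauseVars.1 hS⟩ hβ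
    rw [Finset.mem_Ico]
    omega
  · refine ⟨colourList C (obstructionColour T d), colourList_map_fst,
      Or.inr (Or.inr ⟨h.not_badAt ho, ?_⟩)⟩
    have hcount := ho.count
    rw [← colouredSet_obstructionColour T d] at hcount
    simpa using h.count_iff.1 hcount

end Correctness

open Polynomial Classical in
theorem inCoNP_monotoneForallExistsNAE3SAT (s : ℕ) (hs : 0 < s) :
    InCoNP (MonotoneForallExistsNAE3SAT s 2) := by
  refine ⟨verify s, 2 * X, ⟨verifyComputable hs⟩, fun x => ?_⟩
  by_cases hx : ∃ t : ℕ × ℕ × List Clause, x = code t.1 t.2.1 t.2.2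
  · have hv : ∀ c, verify s (x, c) = true ↔ Accepts s hx.choose.1 hx.choose.2.1
        (headerColour hx.choose.2.2 c) (attach hx.choose.2.2 c).1 := by
      intro c
      rw [verify, dif_pos hx, decide_eq_true_eq]
    simp only [hv]
    generalize ht : hx.choose = t
    have hxt : x = code t.1 t.2.1 t.2.2 := ht ▸ hx.choose_spec
    obtain ⟨p, q, cl⟩ := t
    dsimp only at hxt ⊢
    rw [Set.mem_compl_iff, hxt, mem_language_iff]
    have hfst := attach_map_fst cl
    constructor
    · intro hno
      by_cases hvalid : ValidInput s p q cl
      · obtain ⟨ccl, rfl, ha⟩ := hvalid.exists_accepts fun hy => hno ⟨hvalid, hy⟩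
        have hat := attach_certificate ccl []
        rw [List.append_nil] at hat
        refine ⟨certificate ccl, ?_, ?_⟩
        · have := length_le_length_code p q (ccl.map Prod.fst)
          rw [List.length_map] at this
          rw [length_certificate]
          simp
          omega
        -- The clauses use up the whole certificate, so the header stays uncoloured and adds no
        -- mark.
        · rw [headerColour, hat]
          exact ha
      -- The defects of an invalid formula are found without looking at the colours, so any
      -- certificate serves.
      · refine ⟨[], by simp, ?_⟩
        rw [validInput_iff, not_not] at hvalid
        rcases hvalid with hvalid | hvalid
        · left
          rwa [hfst]
        · right; left
          rw [← hfst []] at hvalid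
          simpa using hvalid
    · rintro ⟨c, -, ha⟩ ⟨hvalid, hyes⟩
      rw [← hfst c] at hvalid hyes
      exact hvalid.not_isYesVal_of_accepts ha hyes
  · refine iff_of_true ?_ ⟨[], by simp, by rw [verify, dif_neg hx]⟩
    rintro ⟨Φ, -, -, rfl⟩
    exact hx ⟨(_, _, _), Φ.encode_eq⟩

end ForallExistsNAE

theorem mainTheorem10 (s : ℕ) (hs : 0 < s) :
    ForallExistsNAE.InCoNP (ForallExistsNAE.MonotoneForallExistsNAE3SAT s 2) :=
  ForallExistsNAE.inCoNP_monotoneForallExistsNAE3SAT s hs
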